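/- Consider $N$ players; player $i$ chooses actions in $\mathbb R^{d_i}$ and has a loss $\ell^i(x)$ of the joint action $x=(x^1,\dots,x^N)$ which is convex and differentiable in $x^i$. Write $V^i(x)=\nabla_{x^i}\ell^i(x)$ and assume that every $V^i$ is $L$-Lipschitz on the joint action space and bounded, $\|V^i(x)\|\le G$. Assume that the game is variationally stable: the set of Nash equilibria is non-empty and $\sum_i\langle V^i(x),x^i-z^i\rangle\ge 0$ for every joint action $x$ and every Nash equilibrium $z$. In every round $t\ge 1$ a joint action $x_t$ is played and player $i$ receives $g_t^i=V^i(x_t)+\xi_t^i$. With $\mathcal F_t=\sigma(x_1,\dots,x_t)$, the noise satisfies $\mathbb E[\xi_t^i\mid\mathcal F_t]=0$ and $\|\xi_t^i\|\le\sigma$ almost surely. All players run OptDA+ from a deterministic point $X_1$: with $g_0^i=0$, $$x_t^i=X_t^i-\eta_t^i\,g_{t-1}^i,\qquad X_{t+1}^i=X_1^i-\gamma_{t+1}^i\sum_{s=1}^{t}g_s^i ,$$ with the adaptive learning rates $$\eta_t^i=\Big(1+\sum_{s=1}^{t-2}\|g_s^i\|^2\Big)^{-(1/2-q)},\qquad \gamma_t^i=\Big(1+\sum_{s=1}^{t-2}\big(\|g_s^i\|^2+\|X_s^i-X_{s+1}^i\|^2\big)\Big)^{-1/2},\qquad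 q\in(0,1/4].$$ For a comparator $p\in\mathbb R^{d_i}$ let $\mathrm{Reg}_T^i(p)=\sum_{t=1}^T\big(\ell^i(x_t)-\ell^i(p,x_t^{-i})\big)$ be the regret and $\mathrm{LinReg}_T^i(p)=\sum_{t=1}^T\langle V^i(x_t),x_t^i-p\rangle$ the linearized regret of player $i$. Let $i$ be a player and $\mathcal P^i\subset\mathbb R^{d_i}$ a bounded set. All constants below depend on the game, $X_1$, $\mathcal P^i$, $\sigma$ (and, in (b), $\sigma_M$), but neither on $T$ nor on $q$ nor on the law of the noise. (a) (Additive noise.) There is a constant $C$ such that, for all $T$, $$\sup_{p\in\mathcal P^i}\mathbb E[\mathrm{LinReg}_T^i(p)]\le C\sqrt T\quad\text{and}\quad \sup_{p\in\mathcal P^i}\mathbb E[\mathrm{Reg}_T^i(p)]\le C\sqrt T .$$ (b) (Multiplicative noise.) If in addition $\mathbb E[\|\xi_t^i\|^2\mid\mathcal F_t]\le\sigma_M^2\|V^i(x_t)\|^2$ almost surely for all players $i$ and all $t\ge1$, then the regret is bounded by a constant that is at most exponential in $1/(2q)$: there are constants $A,B$ such that, for all $T$, $$\mathbb E\Big[\sup_{p\in\mathcal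 P^i}\mathrm{LinReg}_T^i(p)\Big]\le A\,e^{B/(2q)}\quad\text{and}\quad \mathbb E\Big[\sup_{p\in\mathcal P^i}\mathrm{Reg}_T^i(p)\Big]\le A\,e^{B/(2q)} .$$ All these expectations are well defined. -/

import Mathlib

open MeasureTheory
open scoped NNReal InnerProductSpace

namespace NoisyGame

noncomputable section

/-- Action profiles of `N` players, player `i` acting in `ℝ^(d i)`; the norm is the Euclidean norm
of the product space. -/
abbrev Profile {N : ℕ} (d : Fin N → ℕ) : Type :=
  PiLp 2 (fun i => EuclideanSpace ℝ (Fin (d i)))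

/-- The profile `(y, x^{-i})`. -/
def deviate {N : ℕ} {d : Fin N → ℕ} (x : Profile d) (i : Fin N)
    (y : EuclideanSpace ℝ (Fin (d i))) : Profile d :=
  WithLp.toLp 2 (Function.update (WithLp.ofLp x) i y)

/-- The individual gradient `V^i(x) = ∇_{x^i} ℓ^i(x)`. -/
def grad {N : ℕ} {d : Fin N → ℕ} (ℓ : Fin N → Profile d → ℝ) (i : Fin N) (x : Profile d) :
    EuclideanSpace ℝ (Fin (d i)) :=
  gradient (fun y => ℓ i (deviate x i y)) (x i)

/-- Each loss is convex and differentiable in the action of its player, and each individual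
gradient is `L`-Lipschitz on the joint action space. -/
structure IsSmoothConvexGame {N : ℕ} {d : Fin N → ℕ} (ℓ : Fin N → Profile d → ℝ) (L : ℝ≥0) :
    Prop where
  convex : ∀ i x, ConvexOn ℝ Set.univ (fun y => ℓ i (deviate x i y))
  differentiable : ∀ i x, Differentiable ℝ (fun y => ℓ i (deviate x i y))
  lipschitz : ∀ i, LipschitzWith L (grad ℓ i)

/-- Nash equilibria. -/
def IsNash {N : ℕ} {d : Fin N → ℕ} (ℓ : Fin N → Profile d → ℝ) (z : Profile d) : Prop :=
  ∀ i y, ℓ i z ≤ ℓ i (deviate z i y)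

/-- Variational stability. -/
structure IsVariationallyStable {N : ℕ} {d : Fin N → ℕ} (ℓ : Fin N → Profile d → ℝ) : Prop where
  exists_nash : ∃ z, IsNash ℓ z
  stable : ∀ x z, IsNash ℓ z → 0 ≤ ∑ i, ⟪grad ℓ i x, x i - z i⟫_ℝ

/-- The extrapolation rate of player `i` at round `t`:
`(1 + ∑_{s=1}^{t-2} ‖g_s^i‖²)^{-(1/2-q)}`.
(The truncated subtraction `t - 2` makes the sum empty for `t ≤ 2`.) -/
def extrapolationRate {N : ℕ} {d : Fin N → ℕ} (q : ℝ) (g : ℕ → Profile d) (t : ℕ) (i : Fin N) :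
    ℝ :=
  (1 + ∑ s ∈ Finset.Icc 1 (t - 2), ‖g s i‖ ^ 2) ^ (-(1 / 2 - q))

/-- The update rate of player `i` at round `t`:
`(1 + ∑_{s=1}^{t-2} (‖g_s^i‖² + ‖X_s^i - X_{s+1}^i‖²))^{-1/2}`. -/
def updateRate {N : ℕ} {d : Fin N → ℕ} (g X : ℕ → Profile d) (t : ℕ) (i : Fin N) : ℝ :=
  (1 + ∑ s ∈ Finset.Icc 1 (t - 2), (‖g s i‖ ^ 2 + ‖X s i - X (s + 1) i‖ ^ 2)) ^ (-(1 / 2 : ℝ))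

/-- One trajectory of the game in which all players run adaptive OptDA+ from the profile `X₁`,
with noise sequence `ξ`. Rounds are numbered from `1`; `x t` is the profile played in round `t`
(that is, `X_{t+1/2}`), `g t` the feedback received in round `t`, and `X t` the base iterate.
The values of `ξ`, `X`, `x` at index `0` play no role. -/
structure IsAdaptiveOptDAPlus {N : ℕ} {d : Fin N → ℕ} (ℓ : Fin N → Profile d → ℝ) (q : ℝ)
    (X₁ : Profile d) (ξ X x g : ℕ → Profile d) : Prop where
  init : X 1 = X₁
  feedback_zero : g 0 = 0
  play : ∀ t, 1 ≤ t → ∀ i, x t i = X t i - extrapolationRate q g t i • g (t - 1) i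
  feedback : ∀ t, 1 ≤ t → ∀ i, g t i = grad ℓ i (x t) + ξ t i
  update : ∀ t, 1 ≤ t → ∀ i,
    X (t + 1) i = X₁ i - updateRate g X (t + 1) i • ∑ s ∈ Finset.Icc 1 t, g s i

/-- The σ-algebra `F_t` generated by the played profiles `x_1, …, x_t`. -/
abbrev playHistory {N : ℕ} {d : Fin N → ℕ} {Ω : Type*} (x : ℕ → Ω → Profile d) (t : ℕ) :
    MeasurableSpace Ω :=
  ⨆ s ∈ Set.Icc 1 t, MeasurableSpace.comap (x s) inferInstance

/-- The noise is conditionally unbiased given the history of play, and almost surely bounded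
by `σ`. -/
structure IsUnbiasedBoundedNoise {N : ℕ} {d : Fin N → ℕ} {Ω : Type*} [MeasurableSpace Ω]
    (μ : Measure Ω) (ξ x : ℕ → Ω → Profile d) (σ : ℝ) : Prop where
  measurable : ∀ t, 1 ≤ t → Measurable (ξ t)
  unbiased : ∀ t, 1 ≤ t → ∀ i, μ[fun ω => ξ t ω i | playHistory x t] =ᵐ[μ] 0
  bounded : ∀ t, 1 ≤ t → ∀ i, ∀ᵐ ω ∂μ, ‖ξ t ω i‖ ≤ σ

/-- Conditional variance control `E[‖ξ_t^i‖² | F_t] ≤ σA² + σM² ‖V^i(x_t)‖²`. The noise is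
multiplicative when this holds with `σA = 0`. -/
def HasVarianceControl {N : ℕ} {d : Fin N → ℕ} {Ω : Type*} [MeasurableSpace Ω]
    (μ : Measure Ω) (ℓ : Fin N → Profile d → ℝ) (ξ x : ℕ → Ω → Profile d) (σA σM : ℝ) : Prop :=
  ∀ t, 1 ≤ t → ∀ i, μ[fun ω => ‖ξ t ω i‖ ^ 2 | playHistory x t]
    ≤ᵐ[μ] fun ω => σA ^ 2 + σM ^ 2 * ‖grad ℓ i (x t ω)‖ ^ 2

/-- Regret of player `i` after `T` rounds with respect to the comparator `p`. -/
def regret {N : ℕ} {d : Fin N → ℕ} (ℓ : Fin N → Profile d → ℝ) (i : Fin N) (x : ℕ → Profile d)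
    (T : ℕ) (p : EuclideanSpace ℝ (Fin (d i))) : ℝ :=
  ∑ t ∈ Finset.Icc 1 T, (ℓ i (x t) - ℓ i (deviate (x t) i p))

/-- Linearized regret of player `i` after `T` rounds with respect to the comparator `p`. -/
def linRegret {N : ℕ} {d : Fin N → ℕ} (ℓ : Fin N → Profile d → ℝ) (i : Fin N)
    (x : ℕ → Profile d) (T : ℕ) (p : EuclideanSpace ℝ (Fin (d i))) : ℝ :=
  ∑ t ∈ Finset.Icc 1 T, ⟪grad ℓ i (x t), x t i - p⟫_ℝ

/-- `max_{p ∈ P} E[R p] ≤ c`, all the expectations being well defined. -/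
def SupExpectationLE {Ω E : Type*} [MeasurableSpace Ω] (μ : Measure Ω) (P : Set E)
    (R : E → Ω → ℝ) (c : ℝ) : Prop :=
  ∀ p ∈ P, Integrable (R p) μ ∧ ∫ ω, R p ω ∂μ ≤ c

/-- `E[max_{p ∈ P} R p] ≤ c`, the supremum being finite and integrable. -/
def ExpectationSupLE {Ω E : Type*} [MeasurableSpace Ω] (μ : Measure Ω) (P : Set E)
    (R : E → Ω → ℝ) (c : ℝ) : Prop :=
  (∀ ω, BddAbove (Set.range fun p : P => R p ω)) ∧
    Integrable (fun ω => ⨆ p : P, R p ω) μ ∧ ∫ ω, ⨆ p : P, R p ω ∂μ ≤ c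

end

end NoisyGame

/-! The linearized regret is compared with dual averaging run on the noisy feedback. Write each
gradient as feedback minus noise. The optimistic step contributes -η_t⟨g_t, g_{t-1}⟩ in round t; up
to mean-zero terms this is -η_t‖V(x_{t-1})‖² plus errors controlled by ‖V(x_t) - V(x_{t-1})‖² and
η_t²‖g_{t-1}‖². Dual averaging also leaves a negative sum of λ_t‖X_t - X_{t+1}‖² with λ_t = 1/γ_t
(`IsAdaptiveOptDAPlus.linRegret_le`).

Since the gradients are Lipschitz and bounded, their variation is bounded by truncated increments of
the base iterates plus terms η²‖g‖². The truncated increments are absorbed by the negative sum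
(`sum_min_sub_le`). The remaining errors are of the order of the root energies, the energy being 1 +
∑‖g_s‖² (`sum_div_sqrt_cumul_le`).

Take a Nash equilibrium as comparator and sum over the players: by variational stability the total
linearized regret is nonnegative. Hence the negative terms are themselves bounded by noise and root
energies, and this feeds back into the regret of each player (`exists_pathwise_bound`). Taking the
supremum over comparators costs only a multiple of E‖∑ξ_t‖, which is again bounded by a root energy
(`IsNoisyPlay.integral_norm_sum_noise_le`). So everything is at most a constant times 1 + ∑_j
E√energy_j (`exists_dominating`).

For (a), energies grow at most linearly. For (b), the expected weighted gradients dominate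
E[energy^(1/2+q)] up to constants (`IsNoisyPlay.integral_rpow_energy_le`), yet they are at most
linear in E√energy. The larger power wins, so the root energies stay bounded, at the price
(2K)^(1/(2q)). Convexity passes from linearized regret to regret. -/

namespace NoisyGame

/-! ### Inequalities for real sequences and dual averaging. -/

section Deterministic

/-- The regret bound of dual averaging with nondecreasing inverse learning rates `lam`. -/
theorem sum_inner_dualAveraging_add_le {E : Type*} [NormedAddCommGroup E] [InnerProductSpace ℝ E]
    {g X : ℕ → E} {lam : ℕ → ℝ} (hmono : ∀ t, 1 ≤ t → lam t ≤ lam (t + 1))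
    (hX : ∀ t, lam (t + 1) • (X 1 - X (t + 1)) = ∑ s ∈ Finset.Icc 1 t, g s) (p : E) (T : ℕ) :
    ∑ t ∈ Finset.Icc 1 T, ⟪g t, X (t + 1) - p⟫_ℝ + lam (T + 1) / 2 * ‖X (T + 1) - p‖ ^ 2 +
      ∑ t ∈ Finset.Icc 1 T, lam t / 2 * ‖X t - X (t + 1)‖ ^ 2 ≤ lam (T + 1) / 2 * ‖X 1 - p‖ ^ 2 := by
  induction T with
  | zero => simp
  | succ n ih =>
    rw [Finset.sum_Icc_succ_top (by omega), Finset.sum_Icc_succ_top (by omega)]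
    have hg : g (n + 1) = lam (n + 2) • (X 1 - X (n + 2)) - lam (n + 1) • (X 1 - X (n + 1)) := by
      rw [hX (n + 1), hX n, Finset.sum_Icc_succ_top (by omega)]; abel
    have hm := hmono (n + 1) (by omega)
    set a := X 1 - X (n + 2) with ha
    set b := X (n + 2) - p with hb
    set c := X (n + 1) - X (n + 2) with hc
    have e1 : X 1 - X (n + 1) = a - c := by rw [ha, hc]; abel
    have e2 : X (n + 1) - p = c + b := by rw [hb, hc]; abel
    have e3 : X 1 - p = a + b := by rw [ha, hb]; abel
    change _ + ⟪g (n + 1), b⟫_ℝ + lam (n + 2) / 2 * ‖b‖ ^ 2 +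
      (_ + lam (n + 1) / 2 * ‖c‖ ^ 2) ≤ lam (n + 2) / 2 * ‖X 1 - p‖ ^ 2
    rw [e1] at hg
    rw [e2, e3] at ih
    rw [hg, e3]
    clear_value a b c
    have k1 : ⟪lam (n + 2) • a - lam (n + 1) • (a - c), b⟫_ℝ =
        (lam (n + 2) - lam (n + 1)) * ⟪a, b⟫_ℝ + lam (n + 1) * ⟪c, b⟫_ℝ := by
      rw [inner_sub_left, real_inner_smul_left, real_inner_smul_left, inner_sub_left]; ring
    have k2 := norm_add_sq_real a b
    have k3 := norm_add_sq_real c b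
    rw [k1]
    rw [k3] at ih
    rw [k2] at ih ⊢
    change lam (n + 1) ≤ lam (n + 2) at hm
    -- All terms cancel except (`lam (n + 2)` - `lam (n + 1)`) / 2 * ‖a‖², which is nonnegative by
    -- monotonicity.
    nlinarith [mul_nonneg (sub_nonneg.2 hm) (sq_nonneg ‖a‖)]

/-- `1 + ∑_{s=1}^t a_s`. -/
noncomputable def cumul (a : ℕ → ℝ) (t : ℕ) : ℝ := 1 + ∑ s ∈ Finset.Icc 1 t, a s

theorem cumul_succ (a : ℕ → ℝ) (t : ℕ) : cumul a (t + 1) = cumul a t + a (t + 1) := by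
  rw [cumul, cumul, Finset.sum_Icc_succ_top (by omega), add_assoc]

theorem cumul_mono {a : ℕ → ℝ} (ha : ∀ t, 0 ≤ a t) : Monotone (cumul a) :=
  monotone_nat_of_le_succ fun t => by rw [cumul_succ]; linarith [ha (t + 1)]

theorem one_le_cumul {a : ℕ → ℝ} (ha : ∀ t, 0 ≤ a t) (t : ℕ) : 1 ≤ cumul a t := by
  rw [cumul]; linarith [Finset.sum_nonneg fun s (_ : s ∈ Finset.Icc 1 t) => ha s]

theorem cumul_pos {a : ℕ → ℝ} (ha : ∀ t, 0 ≤ a t) (t : ℕ) : 0 < cumul a t :=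
  one_pos.trans_le (one_le_cumul ha t)

/-- Two rounds add at most 2B, and `cumul` is at least 1, so the additive delay becomes a
multiplicative one. -/
theorem cumul_le_cumul_sub_two {a : ℕ → ℝ} {B : ℝ} (ha : ∀ t, 0 ≤ a t) (haB : ∀ t, 1 ≤ t → a t ≤ B)
    (t : ℕ) : cumul a t ≤ (1 + 2 * B) * cumul a (t - 2) := by
  have hB : 0 ≤ B := (ha 1).trans (haB 1 le_rfl)
  have h1 := one_le_cumul ha (t - 2)
  have h2 : cumul a t ≤ cumul a (t - 2) + 2 * B := by
    match t with
    | 0 => simpa using hB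
    | 1 =>
      change cumul a (0 + 1) ≤ cumul a 0 + 2 * B
      rw [cumul_succ]; linarith [haB 1 le_rfl]
    | n + 2 =>
      change cumul a (n + 1 + 1) ≤ cumul a n + 2 * B
      rw [cumul_succ, cumul_succ]; linarith [haB (n + 1) (by omega), haB (n + 1 + 1) (by omega)]
  nlinarith

/-- The self-confident sum bound with feedback delayed by two rounds. -/
theorem sum_div_sqrt_cumul_le {a : ℕ → ℝ} {B : ℝ} (ha : ∀ t, 0 ≤ a t)
    (haB : ∀ t, 1 ≤ t → a t ≤ B) (T : ℕ) :
    ∑ t ∈ Finset.Icc 1 T, a t / √(cumul a (t - 2)) ≤ 2 * √(1 + 2 * B) * √(cumul a T) := by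
  have hB : 0 ≤ B := (ha 1).trans (haB 1 le_rfl)
  induction T with
  | zero => simp; positivity
  | succ n ih =>
    rw [Finset.sum_Icc_succ_top (by omega)]
    set κ := √(1 + 2 * B)
    have hκ : 0 ≤ κ := Real.sqrt_nonneg _
    set v := √(cumul a (n + 1))
    set u := √(cumul a n)
    set w := √(cumul a (n + 1 - 2))
    have hw : 0 < w := Real.sqrt_pos.2 (cumul_pos ha _)
    have hv : 0 < v := Real.sqrt_pos.2 (cumul_pos ha _)
    have hu : 0 ≤ u := Real.sqrt_nonneg _
    have huv : u ≤ v := Real.sqrt_le_sqrt (cumul_mono ha n.le_succ)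
    have hvw : v ≤ κ * w := by
      rw [← Real.sqrt_mul (by positivity)]
      exact Real.sqrt_le_sqrt (cumul_le_cumul_sub_two ha haB _)
    have hsq : a (n + 1) = v ^ 2 - u ^ 2 := by
      rw [Real.sq_sqrt (cumul_pos ha _).le, Real.sq_sqrt (cumul_pos ha _).le, cumul_succ]; ring
    -- Here a = (v - u)(v + u) and v + u ≤ 2v ≤ 2κw, so the quotients telescope.
    have key : a (n + 1) / w ≤ 2 * κ * (v - u) := by
      rw [div_le_iff₀ hw, hsq]
      nlinarith [mul_nonneg (sub_nonneg.2 huv) (sub_nonneg.2 hvw),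
        mul_nonneg (sub_nonneg.2 huv) (sub_nonneg.2 huv)]
    linarith

/-- Truncated squared increments are absorbed by increments weighted with a delayed root of the
cumulated sum. -/
theorem sum_min_sub_le {b lam : ℕ → ℝ} {c K : ℝ} (hb : ∀ t, 0 ≤ b t) (hc : 0 < c) (hK : 0 ≤ K)
    (hlam : ∀ t, √(∑ s ∈ Finset.Icc 1 (t - 2), b s) ≤ lam t) (T : ℕ) :
    ∑ t ∈ Finset.Icc 1 T, (K * min 1 (b t) - c * (lam t * b t)) ≤ K * ((K / c) ^ 2 + 2) := by
  set D : ℕ → ℝ := fun t => ∑ s ∈ Finset.Icc 1 t, min 1 (b s) with hD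
  have hm : ∀ t, 0 ≤ min 1 (b t) := fun t => le_min zero_le_one (hb t)
  have hDs : ∀ t, D (t + 1) = D t + min 1 (b (t + 1)) := fun t => by
    simp only [hD]; rw [Finset.sum_Icc_succ_top (by omega)]
  have hDmono : Monotone D := monotone_nat_of_le_succ fun t => by rw [hDs]; linarith [hm (t + 1)]
  have hD2 : ∀ t, D t ≤ D (t - 2) + 2 := by
    intro t
    match t with
    | 0 => simp
    | 1 =>
      change D (0 + 1) ≤ D 0 + 2
      rw [hDs]; linarith [min_le_left 1 (b (0 + 1))]
    | n + 2 =>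
      change D (n + 1 + 1) ≤ D n + 2
      rw [hDs, hDs]; linarith [min_le_left 1 (b (n + 1)), min_le_left 1 (b (n + 1 + 1))]
  -- Keeping `D T` inside the minimum makes the induction work. A term can be positive only while `c
  -- * lam t < K`; then `D (t - 2) ≤ (K / c) ^ 2`, and the two delayed rounds add at most 2 because
  -- the summands of `D` are truncated at 1.
  suffices h : ∑ t ∈ Finset.Icc 1 T, (K * min 1 (b t) - c * (lam t * b t)) ≤
      K * min (D T) ((K / c) ^ 2 + 2) from
    h.trans (mul_le_mul_of_nonneg_left (min_le_right _ _) hK)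
  induction T with
  | zero => simp [hD]; positivity
  | succ n ih =>
    rw [Finset.sum_Icc_succ_top (by omega)]
    have hl0 : 0 ≤ lam (n + 1) := (Real.sqrt_nonneg _).trans (hlam (n + 1))
    by_cases hcase : c * lam (n + 1) < K
    · have hl : lam (n + 1) < K / c := by rw [lt_div_iff₀ hc]; linarith
      have hle : D (n + 1 - 2) ≤ (K / c) ^ 2 := by
        have h1 : D (n + 1 - 2) ≤ ∑ s ∈ Finset.Icc 1 (n + 1 - 2), b s :=
          Finset.sum_le_sum fun s _ => min_le_right _ _
        have h2 := (Real.sqrt_le_left (hl0.trans hl.le)).1 ((hlam (n + 1)).trans hl.le)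
        linarith
      have hB := hD2 (n + 1)
      rw [min_eq_left (show D (n + 1) ≤ (K / c) ^ 2 + 2 by linarith), hDs]
      have h3 : K * min (D n) ((K / c) ^ 2 + 2) ≤ K * D n :=
        mul_le_mul_of_nonneg_left (min_le_left _ _) hK
      have h4 : 0 ≤ c * (lam (n + 1) * b (n + 1)) := by have := hb (n + 1); positivity
      linarith
    · have h1 : K * min 1 (b (n + 1)) ≤ c * (lam (n + 1) * b (n + 1)) := by
        rw [← mul_assoc]
        exact mul_le_mul (not_lt.1 hcase) (min_le_right _ _) (hm _) (by positivity)
      have h2 : K * min (D n) ((K / c) ^ 2 + 2) ≤ K * min (D (n + 1)) ((K / c) ^ 2 + 2) :=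
        mul_le_mul_of_nonneg_left (min_le_min_right _ (hDmono n.le_succ)) hK
      linarith

theorem mul_sqrt_le_add {K D : ℝ} (hD : 0 ≤ D) : K * √D ≤ D / 16 + 4 * K ^ 2 := by
  have := Real.sq_sqrt hD
  nlinarith [sq_nonneg (√D / 4 - 2 * K)]

theorem sum_Icc_succ_eq_add {M : Type*} [AddCommMonoid M] (f : ℕ → M) (n : ℕ) :
    ∑ t ∈ Finset.Icc 1 (n + 1), f t = f 1 + ∑ s ∈ Finset.Icc 1 n, f (s + 1) := by
  induction n with
  | zero => simp
  | succ n ih => rw [Finset.sum_Icc_succ_top (by omega), ih, Finset.sum_Icc_succ_top (by omega),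
      add_assoc]

/-- Lower bound on a sum weighted with the power `-(1/2 - q)` of a delayed cumulated sum. -/
theorem rpow_cumul_le_sum {a : ℕ → ℝ} {B q : ℝ} (ha : ∀ t, 0 ≤ a t)
    (haB : ∀ t, 1 ≤ t → a t ≤ B) (hq : q ≤ 1 / 2) (n : ℕ) :
    cumul a (n + 1) ^ (1 / 2 + q) ≤
      ∑ s ∈ Finset.Icc 1 n, cumul a (s - 1) ^ (-(1 / 2 - q)) * a s + (1 + B) := by
  have hB : 0 ≤ B := (ha 1).trans (haB 1 le_rfl)
  set U := cumul a (n + 1) with hU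
  have hU1 : 1 ≤ U := one_le_cumul ha _
  have hU0 : 0 < U := one_pos.trans_le hU1
  have hw1 : U ^ (-(1 / 2 - q)) ≤ 1 := Real.rpow_le_one_of_one_le_of_nonpos hU1 (by linarith)
  have hw0 : 0 < U ^ (-(1 / 2 - q)) := Real.rpow_pos_of_pos hU0 _
  -- Every weight is at least the last one, and the last one times `U` is the desired power. The
  -- initial 1 and `a (n + 1)` are missing from the sum; they account for `1 + B`.
  have h1 : ∑ s ∈ Finset.Icc 1 n, U ^ (-(1 / 2 - q)) * a s ≤
      ∑ s ∈ Finset.Icc 1 n, cumul a (s - 1) ^ (-(1 / 2 - q)) * a s := by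
    refine Finset.sum_le_sum fun s hs => mul_le_mul_of_nonneg_right ?_ (ha s)
    refine Real.rpow_le_rpow_of_nonpos (cumul_pos ha _) (cumul_mono ha ?_) (by linarith)
    have := (Finset.mem_Icc.1 hs).2; omega
  rw [← Finset.mul_sum] at h1
  have h2 : U = ∑ s ∈ Finset.Icc 1 n, a s + (1 + a (n + 1)) := by
    rw [hU, cumul_succ, cumul]; ring
  have h3 : U ^ (1 / 2 + q) = U ^ (-(1 / 2 - q)) * U := by
    rw [← Real.rpow_add_one hU0.ne']; congr 1; ring
  have h4 : U ^ (-(1 / 2 - q)) * (1 + a (n + 1)) ≤ 1 * (1 + B) :=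
    mul_le_mul hw1 (by linarith [haB (n + 1) (by omega)]) (by linarith [ha (n + 1)]) zero_le_one
  have h5 : U ^ (1 / 2 + q) = U ^ (-(1 / 2 - q)) * ∑ s ∈ Finset.Icc 1 n, a s +
      U ^ (-(1 / 2 - q)) * (1 + a (n + 1)) := by
    rw [h3]; nth_rewrite 2 [h2]; ring
  linarith

/-- A square root is dominated by a slightly larger power, at an exponential price. -/
theorem mul_sqrt_le_rpow_add {K U q : ℝ} (hK : 1 ≤ K) (hU : 1 ≤ U) (hq : 0 < q) :
    K * √U ≤ U ^ (1 / 2 + q) / 2 + K * Real.exp (Real.log (2 * K) * (1 / (2 * q))) := by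
  have hU0 : 0 < U := one_pos.trans_le hU
  have hs : √U = U ^ (1 / 2 : ℝ) := Real.sqrt_eq_rpow U
  have hs0 : 0 ≤ √U := Real.sqrt_nonneg U
  rw [Real.rpow_add hU0, ← hs]
  have he : Real.exp (Real.log (2 * K) * (1 / (2 * q))) = (2 * K) ^ (1 / (2 * q)) := by
    rw [Real.rpow_def_of_pos (by linarith)]
  rw [he]
  -- Either the extra factor `U ^ q` beats 2K, or `U` itself is at most (2K)^(1/q). The second case
  -- is the source of the exponential dependence on 1/(2q).
  by_cases h : 2 * K ≤ U ^ q
  · have : 0 ≤ K * (2 * K) ^ (1 / (2 * q)) := by positivity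
    nlinarith
  · have h1 : √U ≤ (2 * K) ^ (1 / (2 * q)) := by
      have h2 : (U ^ q) ^ (1 / (2 * q)) ≤ (2 * K) ^ (1 / (2 * q)) :=
        Real.rpow_le_rpow (by positivity) (not_le.1 h).le (by positivity)
      rw [← Real.rpow_mul hU0.le] at h2
      rwa [show q * (1 / (2 * q)) = 1 / 2 by field_simp, ← hs] at h2
    have h3 : 0 ≤ √U * U ^ q / 2 := by positivity
    have h4 : K * √U ≤ K * (2 * K) ^ (1 / (2 * q)) := mul_le_mul_of_nonneg_left h1 (by linarith)
    linarith

end Deterministic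

/-! ### Pathwise regret analysis of a single trajectory. -/

section Trajectory

variable {N : ℕ} {d : Fin N → ℕ}

/-- `1 + ∑_{s=1}^t ‖g_s^j‖²`. -/
noncomputable def energy (g : ℕ → Profile d) (j : Fin N) (t : ℕ) : ℝ :=
  cumul (fun s => ‖g s j‖ ^ 2) t

/-- The inverse of the update rate. -/
noncomputable def invRate (g X : ℕ → Profile d) (j : Fin N) (t : ℕ) : ℝ :=
  √(cumul (fun s => ‖g s j‖ ^ 2 + ‖X s j - X (s + 1) j‖ ^ 2) (t - 2))

/-- `∑_{t=1}^T ‖X_t^j - X_{t+1}^j‖²`. -/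
noncomputable def totalVariation (X : ℕ → Profile d) (j : Fin N) (T : ℕ) : ℝ :=
  ∑ t ∈ Finset.Icc 1 T, ‖X t j - X (t + 1) j‖ ^ 2

/-- The terms of the regret decomposition that vanish in expectation. -/
noncomputable def martingaleTerm (ℓ : Fin N → Profile d → ℝ) (q : ℝ) (ξ x g : ℕ → Profile d)
    (j : Fin N) (n : ℕ) : ℝ :=
  -∑ t ∈ Finset.Icc 1 (n + 1), ⟪x t j, ξ t j⟫_ℝ -
    ∑ s ∈ Finset.Icc 1 n, (⟪extrapolationRate q g (s + 1) j • g s j, ξ (s + 1) j⟫_ℝ +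
      ⟪extrapolationRate q g (s + 1) j • grad ℓ j (x s), ξ s j⟫_ℝ)

/-- The weighted sum of squared gradients produced by optimism. -/
noncomputable def weightedGradSum (ℓ : Fin N → Profile d → ℝ) (q : ℝ) (x g : ℕ → Profile d)
    (j : Fin N) (n : ℕ) : ℝ :=
  ∑ s ∈ Finset.Icc 1 n, extrapolationRate q g (s + 1) j * ‖grad ℓ j (x s)‖ ^ 2

theorem one_le_energy (g : ℕ → Profile d) (j : Fin N) (t : ℕ) : 1 ≤ energy g j t :=
  one_le_cumul (fun _ => by positivity) t

theorem energy_pos (g : ℕ → Profile d) (j : Fin N) (t : ℕ) : 0 < energy g j t :=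
  cumul_pos (fun _ => by positivity) t

theorem energy_mono (g : ℕ → Profile d) (j : Fin N) : Monotone (energy g j) :=
  cumul_mono fun _ => by positivity

theorem extrapolationRate_eq (q : ℝ) (g : ℕ → Profile d) (t : ℕ) (j : Fin N) :
    extrapolationRate q g t j = energy g j (t - 2) ^ (-(1 / 2 - q)) := rfl

theorem extrapolationRate_pos (q : ℝ) (g : ℕ → Profile d) (t : ℕ) (j : Fin N) :
    0 < extrapolationRate q g t j :=
  Real.rpow_pos_of_pos (energy_pos g j _) _

theorem extrapolationRate_le_one {q : ℝ} (hq : q ≤ 1 / 4) (g : ℕ → Profile d) (t : ℕ)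
    (j : Fin N) : extrapolationRate q g t j ≤ 1 :=
  Real.rpow_le_one_of_one_le_of_nonpos (one_le_energy g j _) (by linarith)

/-- Squaring doubles the exponent to 1 - 2q, which is at least 1/2 exactly when q ≤ 1/4. This makes
∑ η²‖g‖² of the order of a root energy. -/
theorem extrapolationRate_sq_le {q : ℝ} (hq : q ≤ 1 / 4) (g : ℕ → Profile d) (t : ℕ)
    (j : Fin N) : extrapolationRate q g t j ^ 2 ≤ 1 / √(energy g j (t - 2)) := by
  have h1 := one_le_energy g j (t - 2)
  have h0 := energy_pos g j (t - 2)
  rw [extrapolationRate_eq, ← Real.rpow_natCast, ← Real.rpow_mul h0.le, Real.sqrt_eq_rpow,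
    one_div (energy g j (t - 2) ^ (1 / 2 : ℝ)), ← Real.rpow_neg h0.le]
  exact Real.rpow_le_rpow_of_exponent_le h1 (by push_cast; linarith)

theorem one_le_invRate (g X : ℕ → Profile d) (j : Fin N) (t : ℕ) : 1 ≤ invRate g X j t :=
  Real.one_le_sqrt.2 (one_le_cumul (fun _ => by positivity) _)

theorem invRate_pos (g X : ℕ → Profile d) (j : Fin N) (t : ℕ) : 0 < invRate g X j t :=
  one_pos.trans_le (one_le_invRate g X j t)

theorem invRate_mono (g X : ℕ → Profile d) (j : Fin N) : Monotone (invRate g X j) :=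
  fun s t h => Real.sqrt_le_sqrt (cumul_mono (fun _ => by positivity) (by omega))

theorem updateRate_eq (g X : ℕ → Profile d) (t : ℕ) (j : Fin N) :
    updateRate g X t j = (invRate g X j t)⁻¹ := by
  have h0 : 0 < cumul (fun s => ‖g s j‖ ^ 2 + ‖X s j - X (s + 1) j‖ ^ 2) (t - 2) :=
    cumul_pos (fun _ => by positivity) _
  rw [invRate, Real.sqrt_eq_rpow, ← Real.rpow_neg h0.le]
  rfl

theorem sqrt_energy_le_invRate (g X : ℕ → Profile d) (j : Fin N) (t : ℕ) :
    √(energy g j (t - 2)) ≤ invRate g X j t := by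
  refine Real.sqrt_le_sqrt (add_le_add le_rfl (Finset.sum_le_sum fun s _ => ?_))
  exact le_add_of_nonneg_right (by positivity)

theorem sqrt_variation_le_invRate (g X : ℕ → Profile d) (j : Fin N) (t : ℕ) :
    √(∑ s ∈ Finset.Icc 1 (t - 2), ‖X s j - X (s + 1) j‖ ^ 2) ≤ invRate g X j t := by
  refine Real.sqrt_le_sqrt (le_add_of_nonneg_of_le zero_le_one (Finset.sum_le_sum fun s _ => ?_))
  exact le_add_of_nonneg_left (by positivity)

theorem totalVariation_nonneg (X : ℕ → Profile d) (j : Fin N) (T : ℕ) :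
    0 ≤ totalVariation X j T := Finset.sum_nonneg fun _ _ => by positivity

theorem weightedGradSum_nonneg (ℓ : Fin N → Profile d → ℝ) (q : ℝ) (x g : ℕ → Profile d)
    (j : Fin N) (n : ℕ) : 0 ≤ weightedGradSum ℓ q x g j n :=
  Finset.sum_nonneg fun _ _ => mul_nonneg (extrapolationRate_pos _ _ _ _).le (by positivity)

theorem invRate_le (g X : ℕ → Profile d) (j : Fin N) (n : ℕ) :
    invRate g X j (n + 2) ≤ √(energy g j (n + 1)) + √(totalVariation X j (n + 1)) := by
  have h : cumul (fun s => ‖g s j‖ ^ 2 + ‖X s j - X (s + 1) j‖ ^ 2) (n + 2 - 2) ≤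
      energy g j (n + 1) + totalVariation X j (n + 1) := by
    refine (cumul_mono (fun _ => by positivity) (show n + 2 - 2 ≤ n + 1 by omega)).trans ?_
    rw [cumul, Finset.sum_add_distrib, energy, cumul, totalVariation, add_assoc]
  refine (Real.sqrt_le_sqrt h).trans (Real.sqrt_le_iff.2 ⟨by positivity, ?_⟩)
  have h1 := Real.sq_sqrt (energy_pos g j (n + 1)).le
  have h2 := Real.sq_sqrt (totalVariation_nonneg X j (n + 1))
  nlinarith [mul_nonneg (Real.sqrt_nonneg (energy g j (n + 1)))
    (Real.sqrt_nonneg (totalVariation X j (n + 1)))]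

variable {ℓ : Fin N → Profile d → ℝ} {q : ℝ} {X₁ : Profile d} {ξ X x g : ℕ → Profile d}

/-- The form of the update required by `sum_inner_dualAveraging_add_le`; for `t = 0` both sides
vanish. -/
theorem IsAdaptiveOptDAPlus.invRate_smul (h : IsAdaptiveOptDAPlus ℓ q X₁ ξ X x g) (j : Fin N)
    (t : ℕ) : invRate g X j (t + 1) • (X 1 j - X (t + 1) j) = ∑ s ∈ Finset.Icc 1 t, g s j := by
  rcases t with _ | t
  · simp
  · rw [h.update (t + 1) (by omega) j, h.init, updateRate_eq, sub_sub_cancel, smul_smul,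
      mul_inv_cancel₀ (invRate_pos _ _ _ _).ne', one_smul]

/-- The pathwise regret bound of one player. -/
theorem IsAdaptiveOptDAPlus.linRegret_le (h : IsAdaptiveOptDAPlus ℓ q X₁ ξ X x g) (j : Fin N)
    (n : ℕ) (p : EuclideanSpace ℝ (Fin (d j))) :
    linRegret ℓ j x (n + 1) p ≤ martingaleTerm ℓ q ξ x g j n +
      ⟪p, ∑ t ∈ Finset.Icc 1 (n + 1), ξ t j⟫_ℝ +
      (∑ s ∈ Finset.Icc 1 n, ‖grad ℓ j (x (s + 1)) - grad ℓ j (x s)‖ ^ 2) / 2 +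
      (∑ s ∈ Finset.Icc 1 n, extrapolationRate q g (s + 1) j ^ 2 * ‖g s j‖ ^ 2) / 2 +
      ∑ t ∈ Finset.Icc 1 (n + 1), ‖g t j‖ ^ 2 / invRate g X j t -
      (∑ t ∈ Finset.Icc 1 (n + 1), invRate g X j t * ‖X t j - X (t + 1) j‖ ^ 2) / 4 +
      invRate g X j (n + 2) / 2 * ‖X₁ j - p‖ ^ 2 - weightedGradSum ℓ q x g j n := by
  have hDA := sum_inner_dualAveraging_add_le (g := fun t => g t j) (X := fun t => X t j)
    (lam := invRate g X j) (fun t _ => invRate_mono g X j (Nat.le_succ t))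
    (h.invRate_smul j) p (n + 1)
  rw [h.init] at hDA
  have hround : ∀ t ∈ Finset.Icc 1 (n + 1), ⟪grad ℓ j (x t), x t j - p⟫_ℝ ≤
      ⟪g t j, X (t + 1) j - p⟫_ℝ + ‖g t j‖ ^ 2 / invRate g X j t +
      invRate g X j t * ‖X t j - X (t + 1) j‖ ^ 2 / 4 - ⟪x t j, ξ t j⟫_ℝ + ⟪p, ξ t j⟫_ℝ +
      -(extrapolationRate q g t j * ⟪g t j, g (t - 1) j⟫_ℝ) := by
    intro t ht
    have ht1 := (Finset.mem_Icc.1 ht).1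
    have hV : grad ℓ j (x t) = g t j - ξ t j := by rw [h.feedback t ht1 j]; abel
    have hx := h.play t ht1 j
    have hl := invRate_pos g X j t
    have e1 : ⟪grad ℓ j (x t), x t j - p⟫_ℝ =
        ⟪g t j, x t j - p⟫_ℝ - ⟪x t j, ξ t j⟫_ℝ + ⟪p, ξ t j⟫_ℝ := by
      rw [hV, inner_sub_left, inner_sub_right (ξ t j), real_inner_comm (x t j) (ξ t j),
        real_inner_comm p (ξ t j)]; ring
    have e2 : ⟪g t j, x t j - p⟫_ℝ = ⟪g t j, X (t + 1) j - p⟫_ℝ + ⟪g t j, X t j - X (t + 1) j⟫_ℝ -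
        extrapolationRate q g t j * ⟪g t j, g (t - 1) j⟫_ℝ := by
      rw [hx, ← real_inner_smul_right, ← inner_add_right, ← inner_sub_right]; congr 1; abel
    -- Young's inequality spends half of the gain λ/2 of dual averaging; the other half, λ/4,
    -- survives in the final bound.
    have e3 : ⟪g t j, X t j - X (t + 1) j⟫_ℝ ≤ ‖g t j‖ ^ 2 / invRate g X j t +
        invRate g X j t * ‖X t j - X (t + 1) j‖ ^ 2 / 4 := by
      refine (real_inner_le_norm _ _).trans ?_
      set l := invRate g X j t
      have : ‖g t j‖ ^ 2 / l + l * ‖X t j - X (t + 1) j‖ ^ 2 / 4 - ‖g t j‖ * ‖X t j - X (t + 1) j‖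
          = (‖g t j‖ - l * ‖X t j - X (t + 1) j‖ / 2) ^ 2 / l := by field_simp; ring
      have h2 : 0 ≤ (‖g t j‖ - l * ‖X t j - X (t + 1) j‖ / 2) ^ 2 / l := by positivity
      linarith
    rw [e1, e2]; linarith
  -- Both factors of ⟨g_{s+1}, g_s⟩ are split into gradient and noise. Since η_{s+1} involves the
  -- feedback only up to round s - 1, both inner products with the noise have mean zero.
  have hopt : ∀ s ∈ Finset.Icc 1 n, -(extrapolationRate q g (s + 1) j * ⟪g (s + 1) j, g s j⟫_ℝ) ≤
      -(⟪extrapolationRate q g (s + 1) j • g s j, ξ (s + 1) j⟫_ℝ +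
      ⟪extrapolationRate q g (s + 1) j • grad ℓ j (x s), ξ s j⟫_ℝ) +
      ‖grad ℓ j (x (s + 1)) - grad ℓ j (x s)‖ ^ 2 / 2 +
      extrapolationRate q g (s + 1) j ^ 2 * ‖g s j‖ ^ 2 / 2 -
      extrapolationRate q g (s + 1) j * ‖grad ℓ j (x s)‖ ^ 2 := by
    intro s hs
    have hs1 := (Finset.mem_Icc.1 hs).1
    set η := extrapolationRate q g (s + 1) j
    set Δ := grad ℓ j (x (s + 1)) - grad ℓ j (x s) with hΔ
    have e1 : ⟪g (s + 1) j, g s j⟫_ℝ = ⟪g s j, ξ (s + 1) j⟫_ℝ + ⟪Δ, g s j⟫_ℝ +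
        ⟪grad ℓ j (x s), ξ s j⟫_ℝ + ‖grad ℓ j (x s)‖ ^ 2 := by
      have k1 : g (s + 1) j = Δ + grad ℓ j (x s) + ξ (s + 1) j := by
        rw [h.feedback (s + 1) (by omega) j, hΔ]; abel
      have k2 : ⟪grad ℓ j (x s), g s j⟫_ℝ = ‖grad ℓ j (x s)‖ ^ 2 + ⟪grad ℓ j (x s), ξ s j⟫_ℝ := by
        rw [h.feedback s hs1 j, inner_add_right, real_inner_self_eq_norm_sq]
      rw [k1, inner_add_left, inner_add_left, k2, real_inner_comm (ξ (s + 1) j)]; ring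
    have e2 : -(η * ⟪Δ, g s j⟫_ℝ) ≤ ‖Δ‖ ^ 2 / 2 + η ^ 2 * ‖g s j‖ ^ 2 / 2 := by
      have k := norm_add_sq_real Δ (η • g s j)
      rw [real_inner_smul_right, norm_smul, mul_pow, Real.norm_eq_abs, sq_abs] at k
      nlinarith [sq_nonneg ‖Δ + η • g s j‖]
    rw [e1, real_inner_smul_left, real_inner_smul_left]
    nlinarith
  have hA := Finset.sum_le_sum hround
  have hB := Finset.sum_le_sum hopt
  simp only [Finset.sum_add_distrib, Finset.sum_sub_distrib, ← Finset.sum_div,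
    Finset.sum_neg_distrib] at hA hB
  rw [sum_Icc_succ_eq_add (fun t => extrapolationRate q g t j * ⟪g t j, g (t - 1) j⟫_ℝ)] at hA
  -- The first round has no previous feedback, so the optimistic sum effectively starts at round 2.
  have h0 : g (1 - 1) j = 0 := by simp [h.feedback_zero]
  rw [h0, inner_zero_right, mul_zero, zero_add] at hA
  simp only [Nat.add_sub_cancel] at hA
  have hC : (∑ t ∈ Finset.Icc 1 (n + 1), invRate g X j t / 2 * ‖X t j - X (t + 1) j‖ ^ 2) =
      (∑ t ∈ Finset.Icc 1 (n + 1), invRate g X j t * ‖X t j - X (t + 1) j‖ ^ 2) / 2 := by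
    rw [Finset.sum_div]; exact Finset.sum_congr rfl fun _ _ => by ring
  rw [hC] at hDA
  have hD : 0 ≤ invRate g X j (n + 1 + 1) / 2 * ‖X (n + 1 + 1) j - p‖ ^ 2 := by
    have := invRate_pos g X j (n + 1 + 1); positivity
  rw [linRegret, martingaleTerm, weightedGradSum, inner_sum, Finset.sum_add_distrib]
  change _ ≤ _ + invRate g X j (n + 1 + 1) / 2 * ‖X₁ j - p‖ ^ 2 - _
  linarith

theorem sum_sq_div_sqrt_energy_le {M : ℝ} (hM : ∀ t, 1 ≤ t → ∀ j, ‖g t j‖ ≤ M) (j : Fin N)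
    (T : ℕ) :
    ∑ t ∈ Finset.Icc 1 T, ‖g t j‖ ^ 2 / √(energy g j (t - 2)) ≤
      2 * √(1 + 2 * M ^ 2) * √(energy g j T) :=
  sum_div_sqrt_cumul_le (a := fun s => ‖g s j‖ ^ 2) (fun _ => by positivity)
    (fun t ht => pow_le_pow_left₀ (norm_nonneg _) (hM t ht j) 2) T

theorem sum_sq_div_invRate_le {M : ℝ} (hM : ∀ t, 1 ≤ t → ∀ j, ‖g t j‖ ≤ M) (j : Fin N) (T : ℕ) :
    ∑ t ∈ Finset.Icc 1 T, ‖g t j‖ ^ 2 / invRate g X j t ≤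
      2 * √(1 + 2 * M ^ 2) * √(energy g j T) := by
  refine (Finset.sum_le_sum fun t _ => ?_).trans (sum_sq_div_sqrt_energy_le hM j T)
  exact div_le_div_of_nonneg_left (by positivity) (Real.sqrt_pos.2 (energy_pos _ _ _))
    (sqrt_energy_le_invRate g X j t)

theorem sum_extrapolationRate_sq_mul_le {M : ℝ} (hM : ∀ t, 1 ≤ t → ∀ j, ‖g t j‖ ≤ M)
    (hq : q ≤ 1 / 4) (j : Fin N) {n T : ℕ} (hnT : n ≤ T) :
    ∑ s ∈ Finset.Icc 1 n, extrapolationRate q g (s + 1) j ^ 2 * ‖g s j‖ ^ 2 ≤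
      2 * √(1 + 2 * M ^ 2) * √(energy g j T) := by
  refine (Finset.sum_le_sum fun s _ => ?_).trans ((sum_sq_div_sqrt_energy_le hM j n).trans
    (mul_le_mul_of_nonneg_left (Real.sqrt_le_sqrt (energy_mono g j hnT)) (by positivity)))
  have h1 := extrapolationRate_sq_le hq g (s + 1) j
  have h2 : 1 / √(energy g j (s + 1 - 2)) ≤ 1 / √(energy g j (s - 2)) :=
    one_div_le_one_div_of_le (Real.sqrt_pos.2 (energy_pos _ _ _))
      (Real.sqrt_le_sqrt (energy_mono g j (by omega)))
  calc _ ≤ 1 / √(energy g j (s - 2)) * ‖g s j‖ ^ 2 :=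
        mul_le_mul_of_nonneg_right (h1.trans h2) (by positivity)
    _ = _ := by ring

theorem sq_norm_add_three_le {E : Type*} [NormedAddCommGroup E] (a b c : E) :
    ‖a + b + c‖ ^ 2 ≤ 3 * (‖a‖ ^ 2 + ‖b‖ ^ 2 + ‖c‖ ^ 2) := by
  have h := norm_add₃_le (a := a) (b := b) (c := c)
  nlinarith [norm_nonneg (a + b + c), sq_nonneg (‖a‖ - ‖b‖), sq_nonneg (‖b‖ - ‖c‖),
    sq_nonneg (‖a‖ - ‖c‖)]

/-- If some u_k is at least 1, the crude bound A is paid by that single index; otherwise no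
truncation occurs. It merges the boundedness and the Lipschitz bounds of the gradients, leaving only
truncated increments. -/
theorem le_sum_min_one_add {ι : Type*} {s : Finset ι} {A B v : ℝ} {u w : ι → ℝ} (hA : 0 ≤ A)
    (hB : 0 ≤ B) (hu : ∀ k, 0 ≤ u k) (hw : ∀ k, 0 ≤ w k) (h1 : v ≤ A)
    (h2 : v ≤ B * ∑ k ∈ s, (u k + w k)) :
    v ≤ ∑ k ∈ s, ((A + B) * min 1 (u k) + B * w k) := by
  have hm : ∀ k, 0 ≤ min 1 (u k) := fun k => le_min zero_le_one (hu k)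
  by_cases h : ∃ k ∈ s, 1 ≤ u k
  · obtain ⟨k, hk, hk1⟩ := h
    have h3 := Finset.single_le_sum (f := fun k => (A + B) * min 1 (u k) + B * w k)
      (fun k _ => by have := hm k; have := hw k; positivity) hk
    simp only [min_eq_left hk1] at h3
    have := mul_nonneg hB (hw k)
    linarith
  · push Not at h
    refine h2.trans ?_
    rw [Finset.mul_sum]
    refine Finset.sum_le_sum fun k hk => ?_
    rw [min_eq_right (h k hk).le]
    have := mul_nonneg hA (hu k)
    linarith

/-- Total squared variation of the gradients along the play. -/
theorem IsAdaptiveOptDAPlus.sum_grad_sub_sq_le (h : IsAdaptiveOptDAPlus ℓ q X₁ ξ X x g) {L : ℝ≥0}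
    {G M : ℝ} (hL : ∀ i, LipschitzWith L (grad ℓ i)) (hG : ∀ i x, ‖grad ℓ i x‖ ≤ G)
    (hM : ∀ t, 1 ≤ t → ∀ j, ‖g t j‖ ≤ M) (hq : q ≤ 1 / 4) (j : Fin N) (n : ℕ) :
    ∑ s ∈ Finset.Icc 1 n, ‖grad ℓ j (x (s + 1)) - grad ℓ j (x s)‖ ^ 2 ≤
      ∑ k, ((4 * G ^ 2 + 3 * L ^ 2) *
          ∑ t ∈ Finset.Icc 1 (n + 1), min 1 (‖X t k - X (t + 1) k‖ ^ 2) +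
        12 * L ^ 2 * √(1 + 2 * M ^ 2) * √(energy g k (n + 1))) := by
  set w : ℕ → Fin N → ℝ := fun s k => extrapolationRate q g (s + 1) k ^ 2 * ‖g s k‖ ^ 2 with hw
  have hw0 : ∀ s k, 0 ≤ w s k := fun s k => by positivity
  have hstep : ∀ s ∈ Finset.Icc 1 n, ‖grad ℓ j (x (s + 1)) - grad ℓ j (x s)‖ ^ 2 ≤
      ∑ k, ((4 * G ^ 2 + 3 * (L : ℝ) ^ 2) * min 1 (‖X s k - X (s + 1) k‖ ^ 2) +
        3 * L ^ 2 * (w s k + w (s - 1) k)) := by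
    intro s hs
    have hs1 := (Finset.mem_Icc.1 hs).1
    refine le_sum_min_one_add (by positivity) (by positivity) (fun k => by positivity)
      (fun k => add_nonneg (hw0 _ _) (hw0 _ _)) ?_ ?_
    · have h1 : ‖grad ℓ j (x (s + 1)) - grad ℓ j (x s)‖ ≤ 2 * G :=
        (norm_sub_le _ _).trans (by linarith [hG j (x (s + 1)), hG j (x s)])
      nlinarith [norm_nonneg (grad ℓ j (x (s + 1)) - grad ℓ j (x s))]
    · have h1 : ‖grad ℓ j (x (s + 1)) - grad ℓ j (x s)‖ ≤ L * ‖x (s + 1) - x s‖ := by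
        rw [← dist_eq_norm, ← dist_eq_norm]; exact (hL j).dist_le_mul _ _
      have h2 : ‖x (s + 1) - x s‖ ^ 2 = ∑ k, ‖x (s + 1) k - x s k‖ ^ 2 := by
        rw [PiLp.norm_sq_eq_of_L2]; rfl
      calc ‖grad ℓ j (x (s + 1)) - grad ℓ j (x s)‖ ^ 2 ≤ (L * ‖x (s + 1) - x s‖) ^ 2 :=
            pow_le_pow_left₀ (norm_nonneg _) h1 2
        _ = L ^ 2 * ∑ k, ‖x (s + 1) k - x s k‖ ^ 2 := by rw [mul_pow, h2]
        _ ≤ L ^ 2 * ∑ k, 3 * (‖X s k - X (s + 1) k‖ ^ 2 + (w s k + w (s - 1) k)) := by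
            refine mul_le_mul_of_nonneg_left (Finset.sum_le_sum fun k _ => ?_) (by positivity)
            have hx : x (s + 1) k - x s k = (X (s + 1) k - X s k) +
                -(extrapolationRate q g (s + 1) k • g s k) +
                extrapolationRate q g s k • g (s - 1) k := by
              rw [h.play (s + 1) (by omega) k, h.play s hs1 k, Nat.add_sub_cancel]; abel
            rw [hx]
            refine (sq_norm_add_three_le _ _ _).trans (le_of_eq ?_)
            rw [norm_neg, norm_smul, norm_smul, mul_pow, mul_pow, Real.norm_eq_abs, sq_abs,
              Real.norm_eq_abs, sq_abs, norm_sub_rev, hw]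
            dsimp only
            rw [Nat.sub_add_cancel hs1]; ring
        _ = 3 * L ^ 2 * ∑ k, (‖X s k - X (s + 1) k‖ ^ 2 + (w s k + w (s - 1) k)) := by
            rw [← Finset.mul_sum]; ring
  refine (Finset.sum_le_sum hstep).trans ?_
  rw [Finset.sum_comm]
  refine Finset.sum_le_sum fun k _ => ?_
  rw [Finset.sum_add_distrib, ← Finset.mul_sum, ← Finset.mul_sum, Finset.sum_add_distrib]
  have h1 : ∑ s ∈ Finset.Icc 1 n, w s k ≤ 2 * √(1 + 2 * M ^ 2) * √(energy g k (n + 1)) :=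
    sum_extrapolationRate_sq_mul_le hM hq k n.le_succ
  have h2 : ∑ s ∈ Finset.Icc 1 n, w (s - 1) k ≤ 2 * √(1 + 2 * M ^ 2) * √(energy g k (n + 1)) := by
    rcases n with _ | n
    · simp; positivity
    · rw [sum_Icc_succ_eq_add (fun s => w (s - 1) k)]
      -- The shifted sum loses nothing at its lower end, because `g 0 = 0`.
      have : w (1 - 1) k = 0 := by simp [hw, h.feedback_zero]
      rw [this, zero_add]
      simp only [Nat.add_sub_cancel]
      exact sum_extrapolationRate_sq_mul_le hM hq k (by omega)
  have h3 : ∑ s ∈ Finset.Icc 1 n, min 1 (‖X s k - X (s + 1) k‖ ^ 2) ≤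
      ∑ t ∈ Finset.Icc 1 (n + 1), min 1 (‖X t k - X (t + 1) k‖ ^ 2) :=
    Finset.sum_le_sum_of_subset_of_nonneg (Finset.Icc_subset_Icc le_rfl n.le_succ)
      fun _ _ _ => le_min zero_le_one (by positivity)
  have h4 := mul_le_mul_of_nonneg_left h3 (show 0 ≤ 4 * G ^ 2 + 3 * (L : ℝ) ^ 2 by positivity)
  have h5 := mul_le_mul_of_nonneg_left (add_le_add h1 h2) (show 0 ≤ 3 * (L : ℝ) ^ 2 by positivity)
  linarith

/-- The part of the pathwise bound with mean zero, for the comparator `p`. -/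
noncomputable def noiseTerm (ℓ : Fin N → Profile d → ℝ) (q : ℝ) (ξ x g : ℕ → Profile d)
    (j : Fin N) (n : ℕ) (p : EuclideanSpace ℝ (Fin (d j))) : ℝ :=
  martingaleTerm ℓ q ξ x g j n + ⟪p, ∑ t ∈ Finset.Icc 1 (n + 1), ξ t j⟫_ℝ

/-- The pathwise regret bound in terms of the energies and of the variation of the base iterates. -/
theorem IsAdaptiveOptDAPlus.linRegret_le_energy (h : IsAdaptiveOptDAPlus ℓ q X₁ ξ X x g)
    {L : ℝ≥0} {G M b : ℝ} (hL : ∀ i, LipschitzWith L (grad ℓ i)) (hG : ∀ i x, ‖grad ℓ i x‖ ≤ G)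
    (hM : ∀ t, 1 ≤ t → ∀ j, ‖g t j‖ ≤ M) (hq : q ≤ 1 / 4) (j : Fin N) (n : ℕ)
    (p : EuclideanSpace ℝ (Fin (d j))) (hb : ‖X₁ j - p‖ ^ 2 ≤ b) :
    linRegret ℓ j x (n + 1) p ≤ noiseTerm ℓ q ξ x g j n p +
      ∑ k, ((4 * G ^ 2 + 3 * L ^ 2) *
          ∑ t ∈ Finset.Icc 1 (n + 1), min 1 (‖X t k - X (t + 1) k‖ ^ 2) +
        12 * L ^ 2 * √(1 + 2 * M ^ 2) * √(energy g k (n + 1))) +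
      (3 * √(1 + 2 * M ^ 2) + b) * √(energy g j (n + 1)) + b * √(totalVariation X j (n + 1)) -
      (∑ t ∈ Finset.Icc 1 (n + 1), invRate g X j t * ‖X t j - X (t + 1) j‖ ^ 2) / 4 -
      weightedGradSum ℓ q x g j n := by
  have h1 := h.linRegret_le j n p
  have h2 := h.sum_grad_sub_sq_le hL hG hM hq j n
  have h3 := sum_extrapolationRate_sq_mul_le hM hq j (n := n) (T := n + 1) n.le_succ
  have h4 := sum_sq_div_invRate_le (X := X) hM j (n + 1)
  have h5 : invRate g X j (n + 2) / 2 * ‖X₁ j - p‖ ^ 2 ≤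
      (√(energy g j (n + 1)) + √(totalVariation X j (n + 1))) * b := by
    have k1 := invRate_le g X j n
    have k2 := invRate_pos g X j (n + 2)
    exact mul_le_mul (by linarith) hb (by positivity) (by positivity)
  have h6 : 0 ≤ ∑ s ∈ Finset.Icc 1 n, ‖grad ℓ j (x (s + 1)) - grad ℓ j (x s)‖ ^ 2 :=
    Finset.sum_nonneg fun _ _ => by positivity
  rw [noiseTerm]
  linarith

theorem totalVariation_le (g X : ℕ → Profile d) (j : Fin N) (T : ℕ) :
    totalVariation X j T ≤
      ∑ t ∈ Finset.Icc 1 T, invRate g X j t * ‖X t j - X (t + 1) j‖ ^ 2 :=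
  Finset.sum_le_sum fun t _ => le_mul_of_one_le_left (by positivity) (one_le_invRate g X j t)

/-- Pathwise bounds with constants that depend on neither the exponent nor the horizon: the
variation of the iterates and the weighted gradients are controlled through variational stability,
and with them the regret of each player. -/
theorem exists_pathwise_bound {L : ℝ≥0} {G : ℝ} (M ρ : ℝ) (X₁ z : Profile d)
    (hL : ∀ i, LipschitzWith L (grad ℓ i)) (hG : ∀ i x, ‖grad ℓ i x‖ ≤ G)
    (hz : ∀ x, 0 ≤ ∑ i, ⟪grad ℓ i x, x i - z i⟫_ℝ) :
    ∃ K c : ℝ, 1 ≤ K ∧ ∀ q : ℝ, q ≤ 1 / 4 → ∀ ξ X x g : ℕ → Profile d,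
      IsAdaptiveOptDAPlus ℓ q X₁ ξ X x g → (∀ t, 1 ≤ t → ∀ j, ‖g t j‖ ≤ M) → ∀ n : ℕ,
      (∑ j, weightedGradSum ℓ q x g j n ≤ ∑ j, noiseTerm ℓ q ξ x g j n (z j) +
        K * (1 + ∑ j, √(energy g j (n + 1)))) ∧
      ∀ j p, ‖p‖ ≤ ρ → linRegret ℓ j x (n + 1) p ≤ noiseTerm ℓ q ξ x g j n p +
        c * ∑ k, noiseTerm ℓ q ξ x g k n (z k) + K * (1 + ∑ k, √(energy g k (n + 1))) := by
  set κ := √(1 + 2 * M ^ 2)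
  set A := 4 * G ^ 2 + 3 * (L : ℝ) ^ 2 with hA
  set B := 12 * (L : ℝ) ^ 2 * κ with hB
  set b := ∑ j, ‖X₁ j - z j‖ ^ 2
  set b' := (‖X₁‖ + |ρ|) ^ 2
  set c₀ := N * A * ((N * A / (1 / 16)) ^ 2 + 2) + 4 * b ^ 2 with hc₀
  set c₁ := N * B + 3 * κ + b with hc₁
  set c₂ := 8 * (A + b') with hc₂
  set c₃ := B + 3 * κ + b' with hc₃
  have hA0 : 0 ≤ A := by positivity
  have hκ0 : 0 ≤ κ := Real.sqrt_nonneg _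
  have hB0 : 0 ≤ B := by positivity
  have hb0 : 0 ≤ b := Finset.sum_nonneg fun _ _ => by positivity
  have hb0' : 0 ≤ b' := by positivity
  have hc00 : 0 ≤ c₀ := by positivity
  have hc10 : 0 ≤ c₁ := by positivity
  have hc20 : 0 ≤ c₂ := by positivity
  have hc30 : 0 ≤ c₃ := by positivity
  have main : ∀ q : ℝ, q ≤ 1 / 4 → ∀ ξ X x g : ℕ → Profile d,
      IsAdaptiveOptDAPlus ℓ q X₁ ξ X x g → (∀ t, 1 ≤ t → ∀ j, ‖g t j‖ ≤ M) → ∀ n : ℕ,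
      (∑ j, weightedGradSum ℓ q x g j n + (∑ j, totalVariation X j (n + 1)) / 8 ≤
        ∑ j, noiseTerm ℓ q ξ x g j n (z j) + N * c₀ + c₁ * ∑ j, √(energy g j (n + 1))) ∧
      ∀ j p, ‖p‖ ≤ ρ → linRegret ℓ j x (n + 1) p ≤ noiseTerm ℓ q ξ x g j n p +
        (A + b') * (∑ k, totalVariation X k (n + 1)) + b' +
          c₃ * ∑ k, √(energy g k (n + 1)) := by
    intro q hq ξ X x g h hM n
    have hm0 : ∀ k : Fin N, ∑ t ∈ Finset.Icc 1 (n + 1), min 1 (‖X t k - X (t + 1) k‖ ^ 2) ≤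
        totalVariation X k (n + 1) := fun k => Finset.sum_le_sum fun _ _ => min_le_right _ _
    have hR0 : ∀ k : Fin N, 0 ≤ √(energy g k (n + 1)) := fun k => Real.sqrt_nonneg _
    constructor
    -- Variational stability, applied round by round.
    · have h0 : 0 ≤ ∑ j, linRegret ℓ j x (n + 1) (z j) := by
        simp only [linRegret]
        rw [Finset.sum_comm]
        exact Finset.sum_nonneg fun t _ => hz (x t)
      have h1 := Finset.sum_le_sum fun j (_ : j ∈ Finset.univ) =>
        h.linRegret_le_energy hL hG hM hq j n (z j) (b := b)
          (Finset.single_le_sum (f := fun j => ‖X₁ j - z j‖ ^ 2) (fun _ _ => by positivity)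
            (Finset.mem_univ j))
      -- Each increment of player k appears once in the bound of each of the N players, hence the
      -- factor N. The gain 1/4 is split into 1/16 for the truncated increments, 1/16 for the root
      -- of the variation and 1/8 kept on the left side.
      have h2 : ∀ k ∈ Finset.univ, (N * (A *
          ∑ t ∈ Finset.Icc 1 (n + 1), min 1 (‖X t k - X (t + 1) k‖ ^ 2)) +
          b * √(totalVariation X k (n + 1)) -
          (∑ t ∈ Finset.Icc 1 (n + 1), invRate g X k t * ‖X t k - X (t + 1) k‖ ^ 2) / 4 +
          totalVariation X k (n + 1) / 8) ≤ c₀ := by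
        intro k _
        have k1 := sum_min_sub_le (b := fun t => ‖X t k - X (t + 1) k‖ ^ 2)
          (lam := invRate g X k) (c := 1 / 16) (K := N * A) (fun _ => by positivity)
          (by norm_num) (by positivity) (sqrt_variation_le_invRate g X k) (n + 1)
        rw [Finset.sum_sub_distrib, ← Finset.mul_sum, ← Finset.mul_sum] at k1
        have k2 := mul_sqrt_le_add (K := b) (totalVariation_nonneg X k (n + 1))
        have k3 := totalVariation_le g X k (n + 1)
        have k4 := totalVariation_nonneg X k (n + 1)
        rw [hc₀]
        linarith
      have h3 := Finset.sum_le_sum h2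
      simp only [Finset.sum_add_distrib, Finset.sum_sub_distrib, Finset.sum_const, Finset.card_univ,
        Fintype.card_fin, nsmul_eq_mul, ← Finset.mul_sum, ← Finset.sum_div] at h1 h3
      rw [hc₁]
      linarith
    · intro j p hp
      have hpb : ‖X₁ j - p‖ ^ 2 ≤ b' := by
        refine pow_le_pow_left₀ (norm_nonneg _) ((norm_sub_le _ _).trans (add_le_add ?_ ?_)) 2
        · exact PiLp.norm_apply_le X₁ j
        · exact hp.trans (le_abs_self ρ)
      have h1 := h.linRegret_le_energy hL hG hM hq j n p hpb
      have h2 := weightedGradSum_nonneg ℓ q x g j n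
      have h3 := (totalVariation_nonneg X j (n + 1)).trans (totalVariation_le g X j (n + 1))
      have h4 : √(totalVariation X j (n + 1)) ≤ 1 + ∑ k, totalVariation X k (n + 1) := by
        have k1 := Finset.single_le_sum (f := fun k => totalVariation X k (n + 1))
          (fun k _ => totalVariation_nonneg X k (n + 1)) (Finset.mem_univ j)
        have k2 := Real.sq_sqrt (totalVariation_nonneg X j (n + 1))
        nlinarith [sq_nonneg (√(totalVariation X j (n + 1)) - 1),
          totalVariation_nonneg X j (n + 1)]
      have h5 := Finset.single_le_sum (f := fun k => √(energy g k (n + 1)))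
          (fun k _ => hR0 k) (Finset.mem_univ j)
      have h6 := mul_le_mul_of_nonneg_left h4 hb0'
      have h7 := mul_le_mul_of_nonneg_left h5 (show 0 ≤ 3 * κ + b' by positivity)
      have h8 := mul_le_mul_of_nonneg_left
        (Finset.sum_le_sum fun k (_ : k ∈ Finset.univ) => hm0 k) hA0
      simp only [Finset.sum_add_distrib, ← Finset.mul_sum] at h1
      rw [hc₃]
      linarith
  refine ⟨1 + (N * c₀ + c₁) + c₂ * (N * c₀ + c₁) + b' + c₃, c₂, ?_, fun q hq ξ X x g h hM n => ?_⟩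
  · have : 0 ≤ c₂ * (N * c₀ + c₁) := by positivity
    have : 0 ≤ N * c₀ := by positivity
    linarith
  obtain ⟨m1, m2⟩ := main q hq ξ X x g h hM n
  have hR : 0 ≤ ∑ k, √(energy g k (n + 1)) := Finset.sum_nonneg fun _ _ => Real.sqrt_nonneg _
  have hT : 0 ≤ ∑ k, totalVariation X k (n + 1) :=
    Finset.sum_nonneg fun _ _ => totalVariation_nonneg _ _ _
  have hH : 0 ≤ ∑ k, weightedGradSum ℓ q x g k n :=
    Finset.sum_nonneg fun _ _ => weightedGradSum_nonneg _ _ _ _ _ _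
  set R := ∑ k, √(energy g k (n + 1))
  have hNc : 0 ≤ N * c₀ := by positivity
  have e1 : 0 ≤ N * c₀ * R := by positivity
  have e2 : 0 ≤ c₁ * R := by positivity
  have e3 : 0 ≤ c₂ * (N * c₀) := by positivity
  have e4 : 0 ≤ c₂ * (N * c₀) * R := by positivity
  have e5 : 0 ≤ c₂ * c₁ := by positivity
  have e6 : 0 ≤ c₂ * c₁ * R := by positivity
  have e7 : 0 ≤ b' * R := by positivity
  have e8 : 0 ≤ c₃ * R := by positivity
  refine ⟨by linarith, fun j p hp => ?_⟩
  have h1 := m2 j p hp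
  -- The stability bound, with the weighted gradients dropped, controls the variation in the
  -- individual regret. The noise enters with the deterministic factor c₂, so its mean remains zero.
  have h2 : ∑ k, totalVariation X k (n + 1) ≤
      8 * (∑ k, noiseTerm ℓ q ξ x g k n (z k) + N * c₀ + c₁ * R) := by linarith
  have h3 := mul_le_mul_of_nonneg_left h2 (add_nonneg hA0 hb0')
  have h4 : (A + b') * (8 * (∑ k, noiseTerm ℓ q ξ x g k n (z k) + N * c₀ + c₁ * R)) =
      c₂ * ∑ k, noiseTerm ℓ q ξ x g k n (z k) + c₂ * (N * c₀) + c₂ * c₁ * R := by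
    rw [hc₂]; ring
  linarith

end Trajectory

/-! ### First-order consequences of convexity and smoothness of the losses. -/

section Game

variable {N : ℕ} {d : Fin N → ℕ} {ℓ : Fin N → Profile d → ℝ} {L : ℝ≥0}

theorem deviate_self (x : Profile d) (i : Fin N) : deviate x i (x i) = x := by
  simp [deviate]

theorem deviate_apply (x : Profile d) (i : Fin N) (y : EuclideanSpace ℝ (Fin (d i))) :
    deviate x i y i = y := by
  simp [deviate]

theorem deviate_deviate (x : Profile d) (i : Fin N) (y y' : EuclideanSpace ℝ (Fin (d i))) :
    deviate (deviate x i y) i y' = deviate x i y' := by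
  simp [deviate]

theorem continuous_deviate {α : Type*} [TopologicalSpace α] {i : Fin N} {f : α → Profile d}
    {h : α → EuclideanSpace ℝ (Fin (d i))} (hf : Continuous f) (hh : Continuous h) :
    Continuous fun a => deviate (f a) i (h a) :=
  (PiLp.continuous_toLp 2 _).comp (((PiLp.continuous_ofLp 2 _).comp hf).update i hh)

theorem IsSmoothConvexGame.hasGradientAt (hℓ : IsSmoothConvexGame ℓ L) (i : Fin N) (x : Profile d)
    (y : EuclideanSpace ℝ (Fin (d i))) :
    HasGradientAt (fun y => ℓ i (deviate x i y)) (grad ℓ i (deviate x i y)) y := by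
  have h : grad ℓ i (deviate x i y) = gradient (fun y => ℓ i (deviate x i y)) y := by
    simp only [grad, deviate_deviate, deviate_apply]
  rw [h]
  exact (hℓ.differentiable i x y).hasGradientAt

theorem IsSmoothConvexGame.hasDerivAt_segment (hℓ : IsSmoothConvexGame ℓ L) (i : Fin N)
    (x : Profile d) (y v : EuclideanSpace ℝ (Fin (d i))) (s : ℝ) :
    HasDerivAt (fun s : ℝ => ℓ i (deviate x i (y + s • v)))
      ⟪grad ℓ i (deviate x i (y + s • v)), v⟫_ℝ s := by
  have h1 := (hℓ.hasGradientAt i x (y + s • v)).hasFDerivAt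
  have h2 : HasDerivAt (fun s : ℝ => y + s • v) v s := by
    simpa using ((hasDerivAt_id s).smul_const v).const_add y
  exact h1.comp_hasDerivAt s h2

/-- The first-order characterization of convexity, between two actions of player `i`. -/
theorem IsSmoothConvexGame.inner_grad_le (hℓ : IsSmoothConvexGame ℓ L) (i : Fin N)
    (x : Profile d) (y p : EuclideanSpace ℝ (Fin (d i))) :
    ⟪grad ℓ i (deviate x i y), p - y⟫_ℝ ≤ ℓ i (deviate x i p) - ℓ i (deviate x i y) := by
  have h1 := hℓ.hasDerivAt_segment i x y (p - y) 0
  have h2 : ConvexOn ℝ Set.univ (fun s : ℝ => ℓ i (deviate x i (y + s • (p - y)))) := by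
    have := (hℓ.convex i x).comp_affineMap (AffineMap.lineMap (k := ℝ) y p)
    simpa [Function.comp_def, AffineMap.lineMap_apply, add_comm] using this
  have h3 := h2.le_slope_of_hasDerivAt (Set.mem_univ 0) (Set.mem_univ 1) one_pos h1
  simpa [slope_def_field] using h3

theorem IsSmoothConvexGame.sub_le_inner (hℓ : IsSmoothConvexGame ℓ L) (i : Fin N)
    (x : Profile d) (p : EuclideanSpace ℝ (Fin (d i))) :
    ℓ i x - ℓ i (deviate x i p) ≤ ⟪grad ℓ i x, x i - p⟫_ℝ := by
  have h := hℓ.inner_grad_le i x (x i) p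
  rw [deviate_self, ← neg_sub, inner_neg_right] at h
  linarith

theorem IsSmoothConvexGame.regret_le_linRegret (hℓ : IsSmoothConvexGame ℓ L) (i : Fin N)
    (x : ℕ → Profile d) (T : ℕ) (p : EuclideanSpace ℝ (Fin (d i))) :
    regret ℓ i x T p ≤ linRegret ℓ i x T p :=
  Finset.sum_le_sum fun t _ => hℓ.sub_le_inner i (x t) p

theorem IsSmoothConvexGame.abs_sub_le (hℓ : IsSmoothConvexGame ℓ L) {G : ℝ}
    (hG : ∀ i x, ‖grad ℓ i x‖ ≤ G) (i : Fin N) (x : Profile d)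
    (p : EuclideanSpace ℝ (Fin (d i))) : |ℓ i x - ℓ i (deviate x i p)| ≤ G * ‖x i - p‖ := by
  have hb : ∀ x', |⟪grad ℓ i x', x i - p⟫_ℝ| ≤ G * ‖x i - p‖ := fun x' =>
    (abs_real_inner_le_norm _ _).trans (mul_le_mul_of_nonneg_right (hG i x') (norm_nonneg _))
  have h1 := hℓ.sub_le_inner i x p
  have h2 := hℓ.inner_grad_le i x p (x i)
  rw [deviate_self] at h2
  rw [abs_le]
  exact ⟨(neg_le_of_abs_le (hb _)).trans h2, h1.trans (le_of_abs_le (hb _))⟩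

theorem continuous_grad (hℓ : IsSmoothConvexGame ℓ L) (i : Fin N) : Continuous (grad ℓ i) :=
  (hℓ.lipschitz i).continuous

/-- The payoff difference caused by a deviation is continuous in the profile, although the loss
itself need not be. -/
theorem IsSmoothConvexGame.continuous_sub_deviate (hℓ : IsSmoothConvexGame ℓ L) (i : Fin N)
    (p : EuclideanSpace ℝ (Fin (d i))) :
    Continuous fun x => ℓ i x - ℓ i (deviate x i p) := by
  have happ : Continuous fun x : Profile d => x i := by fun_prop
  have hc : Continuous (fun a : Profile d × ℝ =>
      ⟪grad ℓ i (deviate a.1 i (p + a.2 • (a.1 i - p))), a.1 i - p⟫_ℝ) := by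
    have h1 : Continuous fun a : Profile d × ℝ => a.1 i - p :=
      (happ.comp continuous_fst).sub continuous_const
    exact ((continuous_grad hℓ i).comp (continuous_deviate continuous_fst
      (continuous_const.add (continuous_snd.smul h1)))).inner h1
  -- The fundamental theorem of calculus on the segment from p to x^i: only the gradient is known to
  -- be continuous in the joint action, and the integral inherits that continuity.
  have heq : (fun x => ℓ i x - ℓ i (deviate x i p)) = fun x => ∫ s in (0 : ℝ)..1,
      ⟪grad ℓ i (deviate x i (p + s • (x i - p))), x i - p⟫_ℝ := by
    funext x
    rw [intervalIntegral.integral_eq_sub_of_hasDerivAt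
      (fun s _ => hℓ.hasDerivAt_segment i x p (x i - p) s)
      ((hc.comp (Continuous.prodMk_right x)).intervalIntegrable 0 1)]
    simp [deviate_self]
  rw [heq]
  exact intervalIntegral.continuous_parametric_intervalIntegral_of_continuous' hc 0 1

theorem continuous_linRegret (i : Fin N) (x : ℕ → Profile d) (T : ℕ) :
    Continuous fun p => linRegret ℓ i x T p := by
  unfold linRegret; fun_prop

theorem continuous_regret (hℓ : IsSmoothConvexGame ℓ L) (i : Fin N) (x : ℕ → Profile d) (T : ℕ) :
    Continuous fun p => regret ℓ i x T p :=
  continuous_finsetSum _ fun t _ => continuous_const.sub (hℓ.differentiable i (x t)).continuous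

theorem abs_linRegret_le {G : ℝ} (hG : ∀ i x, ‖grad ℓ i x‖ ≤ G) (i : Fin N) (x : ℕ → Profile d)
    (T : ℕ) (p : EuclideanSpace ℝ (Fin (d i))) :
    |linRegret ℓ i x T p| ≤ ∑ t ∈ Finset.Icc 1 T, G * ‖x t i - p‖ :=
  (Finset.abs_sum_le_sum_abs _ _).trans (Finset.sum_le_sum fun t _ =>
    (abs_real_inner_le_norm _ _).trans (mul_le_mul_of_nonneg_right (hG i (x t)) (norm_nonneg _)))

theorem abs_regret_le (hℓ : IsSmoothConvexGame ℓ L) {G : ℝ} (hG : ∀ i x, ‖grad ℓ i x‖ ≤ G)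
    (i : Fin N) (x : ℕ → Profile d) (T : ℕ) (p : EuclideanSpace ℝ (Fin (d i))) :
    |regret ℓ i x T p| ≤ ∑ t ∈ Finset.Icc 1 T, G * ‖x t i - p‖ :=
  (Finset.abs_sum_le_sum_abs _ _).trans (Finset.sum_le_sum fun t _ => hℓ.abs_sub_le hG i (x t) p)

end Game

/-! ### Measurability and expectation of suprema over comparators. -/

section Supremum

variable {Ω : Type*} [MeasurableSpace Ω] {E : Type*}

/-- The supremum of a continuously indexed family of measurable functions is measurable. -/
theorem measurable_iSup_of_continuous [TopologicalSpace E] [SecondCountableTopology E] (P : Set E)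
    {R : E → Ω → ℝ}
    (hc : ∀ ω, Continuous fun p => R p ω) (hm : ∀ p, Measurable (R p)) :
    Measurable fun ω => ⨆ p : P, R p ω := by
  obtain ⟨S, hSc, hSd⟩ := TopologicalSpace.exists_countable_dense P
  have : Countable S := hSc
  have h : (fun ω => ⨆ p : P, R p ω) = fun ω => ⨆ s : S, R s ω := by
    funext ω
    exact (hSd.ciSup' (f := fun p : P => R p ω) ((hc ω).comp continuous_subtype_val)).symm
  rw [h]
  exact Measurable.iSup fun s => hm s

/-- A family of functions dominated by `Z` and bounded has a supremum with expectation at most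
that of `Z`. -/
theorem expectationSupLE_of_le [TopologicalSpace E] [SecondCountableTopology E]
    {μ : Measure Ω} [IsProbabilityMeasure μ] {P : Set E} {R : E → Ω → ℝ} {b Z : Ω → ℝ} {C c : ℝ}
    (hc : ∀ ω, Continuous fun p => R p ω) (hm : ∀ p, Measurable (R p))
    (hb : ∀ ω, ∀ p ∈ P, |R p ω| ≤ b ω) (hbC : ∀ᵐ ω ∂μ, b ω ≤ C) (hc0 : 0 ≤ c)
    (hZ : Integrable Z μ) (hRZ : ∀ᵐ ω ∂μ, ∀ p ∈ P, R p ω ≤ Z ω) (hZc : ∫ ω, Z ω ∂μ ≤ c) :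
    ExpectationSupLE μ P R c := by
  have hbdd : ∀ ω, BddAbove (Set.range fun p : P => R p ω) := fun ω => by
    refine ⟨b ω, ?_⟩
    rintro _ ⟨p, rfl⟩
    exact (abs_le.1 (hb ω p p.2)).2
  have hmeas := measurable_iSup_of_continuous P hc hm
  have hIntegrable : Integrable (fun ω => ⨆ p : P, R p ω) μ := by
    refine Integrable.of_bound hmeas.aestronglyMeasurable (max C 0) ?_
    filter_upwards [hbC] with ω hω
    rw [Real.norm_eq_abs]
    rcases isEmpty_or_nonempty P with hP | ⟨⟨p, hp⟩⟩
    -- Over an empty set of comparators the real supremum is 0 by convention; this is also why `0 ≤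
    -- c` is required.
    · rw [Real.iSup_of_isEmpty, abs_zero]; exact le_max_right _ _
    · refine le_max_of_le_left (abs_le.2 ⟨?_, ?_⟩)
      · have h1 := le_ciSup (hbdd ω) ⟨p, hp⟩
        have h2 := (abs_le.1 (hb ω p hp)).1
        dsimp only at h1
        linarith
      · have : Nonempty P := ⟨⟨p, hp⟩⟩
        exact ciSup_le fun p' => (abs_le.1 (hb ω p' p'.2)).2.trans hω
  refine ⟨hbdd, hIntegrable, ?_⟩
  rcases isEmpty_or_nonempty P with hP | hP
  · simpa [Real.iSup_of_isEmpty] using hc0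
  · refine (integral_mono_ae hIntegrable hZ ?_).trans hZc
    filter_upwards [hRZ] with ω hω
    exact ciSup_le fun p => hω p p.2

theorem supExpectationLE_of_le {μ : Measure Ω} [IsProbabilityMeasure μ] {P : Set E}
    {R : E → Ω → ℝ} {b Z : Ω → ℝ} {C c : ℝ} (hm : ∀ p, Measurable (R p))
    (hb : ∀ ω, ∀ p ∈ P, |R p ω| ≤ b ω) (hbC : ∀ᵐ ω ∂μ, b ω ≤ C)
    (hZ : Integrable Z μ) (hRZ : ∀ᵐ ω ∂μ, ∀ p ∈ P, R p ω ≤ Z ω) (hZc : ∫ ω, Z ω ∂μ ≤ c) :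
    SupExpectationLE μ P R c := by
  intro p hp
  have hIntegrable : Integrable (R p) μ := by
    refine Integrable.of_bound (hm p).aestronglyMeasurable C ?_
    filter_upwards [hbC] with ω hω
    exact (hb ω p hp).trans hω
  refine ⟨hIntegrable, (integral_mono_ae hIntegrable hZ ?_).trans hZc⟩
  filter_upwards [hRZ] with ω hω using hω p hp

end Supremum

/-! ### Closure properties of almost surely bounded functions. -/

section AEBounded

variable {Ω : Type*} [MeasurableSpace Ω] {μ : Measure Ω}
variable {E : Type*} [NormedAddCommGroup E]

/-- Almost everywhere strongly measurable and almost everywhere bounded functions. -/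
def AEBounded (μ : Measure Ω) (f : Ω → E) : Prop :=
  AEStronglyMeasurable f μ ∧ ∃ C : ℝ, ∀ᵐ ω ∂μ, ‖f ω‖ ≤ C

theorem AEBounded.integrable [IsFiniteMeasure μ] {f : Ω → E} (hf : AEBounded μ f) :
    Integrable f μ :=
  let ⟨hm, C, hC⟩ := hf
  Integrable.of_bound hm C hC

theorem AEBounded.const (c : E) : AEBounded μ fun _ => c :=
  ⟨aestronglyMeasurable_const, ‖c‖, Filter.Eventually.of_forall fun _ => le_rfl⟩

theorem AEBounded.add {f h : Ω → E} (hf : AEBounded μ f) (hh : AEBounded μ h) :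
    AEBounded μ fun ω => f ω + h ω := by
  obtain ⟨hm, C, hC⟩ := hf
  obtain ⟨hm', C', hC'⟩ := hh
  refine ⟨hm.add hm', C + C', ?_⟩
  filter_upwards [hC, hC'] with ω h1 h2 using (norm_add_le _ _).trans (add_le_add h1 h2)

theorem AEBounded.neg {f : Ω → E} (hf : AEBounded μ f) : AEBounded μ fun ω => -f ω := by
  obtain ⟨hm, C, hC⟩ := hf
  exact ⟨hm.neg, C, by simpa using hC⟩

theorem AEBounded.sub {f h : Ω → E} (hf : AEBounded μ f) (hh : AEBounded μ h) :
    AEBounded μ fun ω => f ω - h ω := by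
  simpa only [sub_eq_add_neg] using hf.add hh.neg

theorem AEBounded.sum {ι : Type*} {s : Finset ι} {f : ι → Ω → E}
    (hf : ∀ k ∈ s, AEBounded μ (f k)) : AEBounded μ fun ω => ∑ k ∈ s, f k ω := by
  classical
  induction s using Finset.induction_on with
  | empty => simpa using AEBounded.const (μ := μ) (0 : E)
  | insert a s ha ih =>
    simp only [Finset.sum_insert ha]
    exact (hf a (Finset.mem_insert_self a s)).add
      (ih fun k hk => hf k (Finset.mem_insert_of_mem hk))

theorem AEBounded.norm {f : Ω → E} (hf : AEBounded μ f) : AEBounded μ fun ω => ‖f ω‖ := by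
  obtain ⟨hm, C, hC⟩ := hf
  exact ⟨hm.norm, C, by simpa using hC⟩

theorem AEBounded.smul [NormedSpace ℝ E] {c : Ω → ℝ} {f : Ω → E} (hc : AEBounded μ c)
    (hf : AEBounded μ f) : AEBounded μ fun ω => c ω • f ω := by
  obtain ⟨hm, C, hC⟩ := hf
  obtain ⟨hm', C', hC'⟩ := hc
  refine ⟨hm'.smul hm, C' * C, ?_⟩
  filter_upwards [hC, hC'] with ω h1 h2
  rw [norm_smul]
  exact mul_le_mul h2 h1 (norm_nonneg _) ((norm_nonneg _).trans h2)

theorem AEBounded.mul {c f : Ω → ℝ} (hc : AEBounded μ c) (hf : AEBounded μ f) :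
    AEBounded μ fun ω => c ω * f ω := hc.smul hf

theorem AEBounded.norm_sq {f : Ω → E} (hf : AEBounded μ f) : AEBounded μ fun ω => ‖f ω‖ ^ 2 := by
  simpa only [sq] using hf.norm.mul hf.norm

theorem AEBounded.inner [InnerProductSpace ℝ E] {f h : Ω → E} (hf : AEBounded μ f)
    (hh : AEBounded μ h) : AEBounded μ fun ω => ⟪f ω, h ω⟫_ℝ := by
  obtain ⟨hm, C, hC⟩ := hf
  obtain ⟨hm', C', hC'⟩ := hh
  refine ⟨hm.inner hm', C * C', ?_⟩
  filter_upwards [hC, hC'] with ω h1 h2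
  exact (norm_inner_le_norm _ _).trans (mul_le_mul h1 h2 (norm_nonneg _) ((norm_nonneg _).trans h1))

end AEBounded

/-! ### Pulling known factors out of conditional expectations. -/

section Conditioning

variable {Ω : Type*} {m m0 : MeasurableSpace Ω} {μ : Measure Ω} [IsFiniteMeasure μ]
variable {E : Type*} [NormedAddCommGroup E] [InnerProductSpace ℝ E] [CompleteSpace E]

theorem integral_inner_eq_zero_of_condExp {h ξ : Ω → E} (hm : m ≤ m0)
    (hh : StronglyMeasurable[m] h) (hhb : AEBounded μ h) (hξb : AEBounded μ ξ)
    (hξ : μ[ξ | m] =ᵐ[μ] 0) : ∫ ω, ⟪h ω, ξ ω⟫_ℝ ∂μ = 0 := by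
  have h1 := condExp_bilin_of_stronglyMeasurable_left (innerSL ℝ) hh
    ((hhb.inner hξb).integrable) hξb.integrable
  calc ∫ ω, ⟪h ω, ξ ω⟫_ℝ ∂μ = ∫ ω, μ[fun ω => innerSL ℝ (h ω) (ξ ω) | m] ω ∂μ :=
        (integral_condExp hm).symm
    _ = ∫ ω, (0 : ℝ) ∂μ := by
        refine integral_congr_ae ?_
        filter_upwards [h1, hξ] with ω h2 h3
        rw [h2, h3]; simp
    _ = 0 := by simp

theorem integral_mul_le_of_condExp_le {w f F : Ω → ℝ} (hm : m ≤ m0)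
    (hw : StronglyMeasurable[m] w) (hw0 : ∀ ω, 0 ≤ w ω) (hwb : AEBounded μ w)
    (hf : AEBounded μ f) (hF : AEBounded μ F) (hle : μ[f | m] ≤ᵐ[μ] F) :
    ∫ ω, w ω * f ω ∂μ ≤ ∫ ω, w ω * F ω ∂μ := by
  have h1 := condExp_mul_of_stronglyMeasurable_left (μ := μ) hw
    (show Integrable (w * f) μ from (hwb.mul hf).integrable) hf.integrable
  have h2 : ∫ ω, w ω * f ω ∂μ = ∫ ω, μ[w * f | m] ω ∂μ := (integral_condExp hm).symm
  rw [h2]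
  refine integral_mono_ae integrable_condExp (hwb.mul hF).integrable ?_
  filter_upwards [h1, hle] with ω h3 h4
  rw [h3]
  exact mul_le_mul_of_nonneg_left h4 (hw0 ω)

end Conditioning

/-! ### Measurability of the play with respect to its own history. -/

section Play

variable {N : ℕ} {d : Fin N → ℕ} {Ω : Type*}

theorem measurable_profile {m : MeasurableSpace Ω} {f : Ω → Profile d}
    (h : ∀ i, Measurable[m] fun ω => f ω i) : Measurable[m] f := by
  have h1 : Measurable[m] fun ω => WithLp.ofLp (f ω) := measurable_pi_iff.2 h
  exact (WithLp.measurable_toLp 2 _).comp h1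

theorem measurable_profile_apply {m : MeasurableSpace Ω} {f : Ω → Profile d}
    (h : Measurable[m] f) (i : Fin N) : Measurable[m] fun ω => f ω i :=
  (show Continuous fun y : Profile d => y i by fun_prop).measurable.comp h

theorem measurable_energy {m : MeasurableSpace Ω} {g : ℕ → Ω → Profile d} {j : Fin N} {t : ℕ}
    (hg : ∀ s, 1 ≤ s → s ≤ t → Measurable[m] fun ω => g s ω j) :
    Measurable[m] fun ω => energy (g · ω) j t := by
  unfold energy cumul
  refine measurable_const.add (Finset.measurable_fun_sum _ fun s hs => ?_)
  exact (hg s (Finset.mem_Icc.1 hs).1 (Finset.mem_Icc.1 hs).2).norm.pow_const 2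

theorem measurable_extrapolationRate {m : MeasurableSpace Ω} {g : ℕ → Ω → Profile d} {j : Fin N}
    {t : ℕ} (q : ℝ) (hg : ∀ s, 1 ≤ s → s ≤ t - 2 → Measurable[m] fun ω => g s ω j) :
    Measurable[m] fun ω => extrapolationRate q (g · ω) t j :=
  (measurable_energy hg).pow_const _

theorem measurable_updateRate {m : MeasurableSpace Ω} {g X : ℕ → Ω → Profile d} {j : Fin N}
    {t : ℕ} (hg : ∀ s, 1 ≤ s → s ≤ t - 2 → Measurable[m] fun ω => g s ω j)
    (hX : ∀ s, 1 ≤ s → s ≤ t - 1 → Measurable[m] fun ω => X s ω j) :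
    Measurable[m] fun ω => updateRate (g · ω) (X · ω) t j := by
  unfold updateRate
  refine Measurable.pow_const (measurable_const.add
    (Finset.measurable_fun_sum _ fun s hs => ?_)) _
  have h := Finset.mem_Icc.1 hs
  exact ((hg s h.1 h.2).norm.pow_const 2).add
    (((hX s h.1 (by omega)).sub (hX (s + 1) (by omega) (by omega))).norm.pow_const 2)

theorem playHistory_mono (x : ℕ → Ω → Profile d) {s t : ℕ} (h : s ≤ t) :
    playHistory x s ≤ playHistory x t :=
  biSup_mono fun _ hr => ⟨hr.1, hr.2.trans h⟩

theorem measurable_play (x : ℕ → Ω → Profile d) {s t : ℕ} (hs : 1 ≤ s) (hst : s ≤ t) :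
    Measurable[playHistory x t] (x s) :=
  Measurable.mono (comap_measurable (x s))
    (le_biSup (fun s => MeasurableSpace.comap (x s) inferInstance) (Set.mem_Icc.2 ⟨hs, hst⟩)) le_rfl

variable [m0 : MeasurableSpace Ω]

/-- All players run adaptive OptDA+ against unbiased bounded noise in a smooth convex game with
bounded gradients. -/
structure IsNoisyPlay (μ : Measure Ω) (ℓ : Fin N → Profile d → ℝ) (L : ℝ≥0) (G σ q : ℝ)
    (X₁ : Profile d) (ξ X x g : ℕ → Ω → Profile d) : Prop where
  game : IsSmoothConvexGame ℓ L
  grad_le : ∀ i x, ‖grad ℓ i x‖ ≤ G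
  le_quarter : q ≤ 1 / 4
  path : ∀ ω, IsAdaptiveOptDAPlus ℓ q X₁ (ξ · ω) (X · ω) (x · ω) (g · ω)
  noise : IsUnbiasedBoundedNoise μ ξ x σ

variable {μ : Measure Ω} {ℓ : Fin N → Profile d → ℝ} {L : ℝ≥0} {G σ q : ℝ}
  {X₁ : Profile d} {ξ X x g : ℕ → Ω → Profile d}

theorem IsNoisyPlay.measurable (H : IsNoisyPlay μ ℓ L G σ q X₁ ξ X x g) (t : ℕ) (ht : 1 ≤ t) :
    Measurable (X t) ∧ Measurable (x t) ∧ Measurable (g t) := by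
  induction t using Nat.strong_induction_on with
  | _ t ih =>
  have hg : ∀ s, 1 ≤ s → s < t → ∀ j, Measurable fun ω => g s ω j :=
    fun s hs hst j => measurable_profile_apply (ih s hst hs).2.2 j
  have hX' : ∀ s, 1 ≤ s → s < t → ∀ j, Measurable fun ω => X s ω j :=
    fun s hs hst j => measurable_profile_apply (ih s hst hs).1 j
  have hX : Measurable (X t) := by
    rcases Nat.lt_or_ge t 2 with h2 | h2
    · obtain rfl : t = 1 := by omega
      have : X 1 = fun _ => X₁ := funext fun ω => (H.path ω).init
      rw [this]; exact measurable_const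
    · obtain ⟨n, rfl⟩ : ∃ n, t = n + 1 := ⟨t - 1, by omega⟩
      refine measurable_profile fun j => ?_
      have : (fun ω => X (n + 1) ω j) = fun ω => X₁ j -
          updateRate (g · ω) (X · ω) (n + 1) j • ∑ s ∈ Finset.Icc 1 n, g s ω j :=
        funext fun ω => (H.path ω).update n (by omega) j
      rw [this]
      refine measurable_const.sub (Measurable.smul (measurable_updateRate
        (fun s h1 h2 => hg s h1 (by omega) j) (fun s h1 h2 => hX' s h1 (by omega) j))
        (Finset.measurable_fun_sum _ fun s hs => ?_))
      have h := Finset.mem_Icc.1 hs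
      exact hg s h.1 (by omega) j
  have hx : Measurable (x t) := by
    refine measurable_profile fun j => ?_
    have : (fun ω => x t ω j) = fun ω => X t ω j -
        extrapolationRate q (g · ω) t j • g (t - 1) ω j := funext fun ω => (H.path ω).play t ht j
    rw [this]
    refine (measurable_profile_apply hX j).sub (Measurable.smul (measurable_extrapolationRate q
        (fun s h1 h2 => hg s h1 (by omega) j)) ?_)
    rcases Nat.lt_or_ge t 2 with h2 | h2
    · obtain rfl : t = 1 := by omega
      have : (fun ω => g (1 - 1) ω j) = fun _ => 0 := funext fun ω => by
        have := (H.path ω).feedback_zero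
        simp [this]
      rw [this]; exact measurable_const
    · exact hg (t - 1) (by omega) (by omega) j
  refine ⟨hX, hx, measurable_profile fun j => ?_⟩
  have : (fun ω => g t ω j) = fun ω => grad ℓ j (x t ω) + ξ t ω j :=
    funext fun ω => (H.path ω).feedback t ht j
  rw [this]
  exact ((continuous_grad H.game j).measurable.comp hx).add
    (measurable_profile_apply (H.noise.measurable t ht) j)

theorem IsNoisyPlay.playHistory_le (H : IsNoisyPlay μ ℓ L G σ q X₁ ξ X x g) (t : ℕ) :
    playHistory x t ≤ m0 :=
  iSup₂_le fun s hs => (H.measurable s hs.1).2.1.comap_le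

/-- The feedback of the past rounds and the current base iterate can be read off the history of
play. -/
theorem IsNoisyPlay.adapted (H : IsNoisyPlay μ ℓ L G σ q X₁ ξ X x g) (j : Fin N) (t : ℕ) :
    (∀ s, 1 ≤ s → s < t → Measurable[playHistory x t] fun ω => g s ω j) ∧
      ∀ s, 1 ≤ s → s ≤ t → Measurable[playHistory x t] fun ω => X s ω j := by
  induction t with
  | zero => exact ⟨fun s h1 h2 => by omega, fun s h1 h2 => by omega⟩
  | succ n ih =>
    have hmono := playHistory_mono x n.le_succ
    have ihg : ∀ s, 1 ≤ s → s < n → Measurable[playHistory x (n + 1)] fun ω => g s ω j :=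
      fun s h1 h2 => (ih.1 s h1 h2).mono hmono le_rfl
    have ihX : ∀ s, 1 ≤ s → s ≤ n → Measurable[playHistory x (n + 1)] fun ω => X s ω j :=
      fun s h1 h2 => (ih.2 s h1 h2).mono hmono le_rfl
    rcases n with _ | n
    · refine ⟨fun s h1 h2 => by omega, fun s h1 h2 => ?_⟩
      obtain rfl : s = 1 := by omega
      have : (fun ω => X 1 ω j) = fun _ => X₁ j := funext fun ω => by
        have : X 1 ω = X₁ := (H.path ω).init
        rw [this]
      rw [this]; exact measurable_const
    · have hγ : Measurable[playHistory x (n + 1 + 1)] fun ω =>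
          updateRate (g · ω) (X · ω) (n + 1 + 1) j :=
        measurable_updateRate (fun s h1 h2 => ihg s h1 (by omega))
          (fun s h1 h2 => ihX s h1 (by omega))
      have hη : Measurable[playHistory x (n + 1 + 1)] fun ω =>
          extrapolationRate q (g · ω) (n + 1 + 1) j :=
        measurable_extrapolationRate q (fun s h1 h2 => ihg s h1 (by omega))
      have hS : Measurable[playHistory x (n + 1 + 1)] fun ω => ∑ s ∈ Finset.Icc 1 n, g s ω j :=
        Finset.measurable_fun_sum _ fun s hs =>
          ihg s (Finset.mem_Icc.1 hs).1 (by have := (Finset.mem_Icc.1 hs).2; omega)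
      have hx : Measurable[playHistory x (n + 1 + 1)] fun ω => x (n + 1 + 1) ω j :=
        measurable_profile_apply (measurable_play x (by omega) le_rfl) j
      -- The action of round n + 2 contains g_{n+1} twice: through the base iterate with coefficient
      -- -γ and through the extrapolation with -η. Both rates depend on older data and γ + η > 0, so
      -- the equation can be solved for g_{n+1}.
      have hg : Measurable[playHistory x (n + 1 + 1)] fun ω => g (n + 1) ω j := by
        have : (fun ω => g (n + 1) ω j) = fun ω =>
            (updateRate (g · ω) (X · ω) (n + 1 + 1) j +
              extrapolationRate q (g · ω) (n + 1 + 1) j)⁻¹ •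
            (X₁ j - updateRate (g · ω) (X · ω) (n + 1 + 1) j • ∑ s ∈ Finset.Icc 1 n, g s ω j -
              x (n + 1 + 1) ω j) := by
          funext ω
          have h1 := (H.path ω).play (n + 1 + 1) (by omega) j
          rw [(H.path ω).update (n + 1) (by omega) j, Nat.add_sub_cancel,
            Finset.sum_Icc_succ_top (by omega)] at h1
          have h2 := extrapolationRate_pos q (g · ω) (n + 1 + 1) j
          have h3 : 0 < updateRate (g · ω) (X · ω) (n + 1 + 1) j := by
            rw [updateRate_eq]; exact inv_pos.2 (invRate_pos _ _ _ _)
          rw [h1]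
          set a := updateRate (g · ω) (X · ω) (n + 1 + 1) j
          set b := extrapolationRate q (g · ω) (n + 1 + 1) j
          have h4 : ∀ S v y : EuclideanSpace ℝ (Fin (d j)),
              y - a • S - (y - a • (S + v) - b • v) = (a + b) • v := fun S v y => by module
          rw [h4, smul_smul, inv_mul_cancel₀ (by positivity), one_smul]
        rw [this]
        exact (hγ.add hη).inv.smul ((measurable_const.sub (hγ.smul hS)).sub hx)
      have hg' : ∀ s, 1 ≤ s → s < n + 1 + 1 →
          Measurable[playHistory x (n + 1 + 1)] fun ω => g s ω j := by
        intro s h1 h2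
        rcases Nat.lt_or_ge s (n + 1) with h | h
        · exact ihg s h1 h
        · obtain rfl : s = n + 1 := by omega
          exact hg
      refine ⟨hg', fun s h1 h2 => ?_⟩
      rcases Nat.lt_or_ge s (n + 1 + 1) with h | h
      · exact ihX s h1 (by omega)
      · obtain rfl : s = n + 1 + 1 := by omega
        have : (fun ω => X (n + 1 + 1) ω j) = fun ω => X₁ j -
            updateRate (g · ω) (X · ω) (n + 1 + 1) j • ∑ s ∈ Finset.Icc 1 (n + 1), g s ω j :=
          funext fun ω => (H.path ω).update (n + 1) (by omega) j
        rw [this]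
        exact measurable_const.sub (hγ.smul (Finset.measurable_fun_sum _ fun s hs =>
          hg' s (Finset.mem_Icc.1 hs).1 (by have := (Finset.mem_Icc.1 hs).2; omega)))

end Play

/-! ### Integrability, vanishing noise terms and energy estimates in expectation. -/

section Expectation

variable {N : ℕ} {d : Fin N → ℕ} {Ω : Type*} [m0 : MeasurableSpace Ω]
variable {μ : Measure Ω} {ℓ : Fin N → Profile d → ℝ} {L : ℝ≥0} {G σ q : ℝ}
  {X₁ : Profile d} {ξ X x g : ℕ → Ω → Profile d}

theorem IsNoisyPlay.norm_feedback_le (H : IsNoisyPlay μ ℓ L G σ q X₁ ξ X x g) :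
    ∀ᵐ ω ∂μ, ∀ t, 1 ≤ t → ∀ j, ‖g t ω j‖ ≤ G + σ := by
  have h : ∀ᵐ ω ∂μ, ∀ t, 1 ≤ t → ∀ j, ‖ξ t ω j‖ ≤ σ := by
    rw [ae_all_iff]; intro t
    by_cases ht : 1 ≤ t
    · filter_upwards [ae_all_iff.2 fun j => H.noise.bounded t ht j] with ω hω _ using hω
    · exact Filter.Eventually.of_forall fun ω h => absurd h ht
  filter_upwards [h] with ω hω t ht j
  rw [(H.path ω).feedback t ht j]
  exact (norm_add_le _ _).trans (add_le_add (H.grad_le _ _) (hω t ht j))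

theorem IsNoisyPlay.aeBounded_noise (H : IsNoisyPlay μ ℓ L G σ q X₁ ξ X x g) (j : Fin N) {t : ℕ}
    (ht : 1 ≤ t) : AEBounded μ fun ω => ξ t ω j :=
  ⟨(measurable_profile_apply (H.noise.measurable t ht) j).aestronglyMeasurable, σ,
    H.noise.bounded t ht j⟩

theorem IsNoisyPlay.aeBounded_grad (H : IsNoisyPlay μ ℓ L G σ q X₁ ξ X x g) (j : Fin N) {t : ℕ}
    (ht : 1 ≤ t) : AEBounded μ fun ω => grad ℓ j (x t ω) :=
  ⟨((continuous_grad H.game j).measurable.comp (H.measurable t ht).2.1).aestronglyMeasurable, G,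
    Filter.Eventually.of_forall fun _ => H.grad_le _ _⟩

theorem IsNoisyPlay.aeBounded_feedback (H : IsNoisyPlay μ ℓ L G σ q X₁ ξ X x g) (j : Fin N)
    {t : ℕ} (ht : 1 ≤ t) : AEBounded μ fun ω => g t ω j :=
  ⟨(measurable_profile_apply (H.measurable t ht).2.2 j).aestronglyMeasurable, G + σ, by
    filter_upwards [H.norm_feedback_le] with ω hω using hω t ht j⟩

theorem IsNoisyPlay.measurable_feedback (H : IsNoisyPlay μ ℓ L G σ q X₁ ξ X x g) (j : Fin N)
    {t : ℕ} (ht : 1 ≤ t) : Measurable fun ω => g t ω j :=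
  measurable_profile_apply (H.measurable t ht).2.2 j

theorem IsNoisyPlay.aeBounded_extrapolationRate (H : IsNoisyPlay μ ℓ L G σ q X₁ ξ X x g)
    (j : Fin N) (t : ℕ) : AEBounded μ fun ω => extrapolationRate q (g · ω) t j :=
  ⟨(measurable_extrapolationRate q fun _ h _ => H.measurable_feedback j h).aestronglyMeasurable, 1,
    Filter.Eventually.of_forall fun ω => by
      rw [Real.norm_eq_abs, abs_of_pos (extrapolationRate_pos _ _ _ _)]
      exact extrapolationRate_le_one H.le_quarter _ _ _⟩

/-- The rate is at most 1 and each feedback is bounded. The resulting bound depends on `t` and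
serves integrability only. -/
theorem IsNoisyPlay.aeBounded_iterate (H : IsNoisyPlay μ ℓ L G σ q X₁ ξ X x g) (j : Fin N) {t : ℕ}
    (ht : 1 ≤ t) : AEBounded μ fun ω => X t ω j := by
  rcases Nat.lt_or_ge t 2 with h2 | h2
  · obtain rfl : t = 1 := by omega
    have : (fun ω => X 1 ω j) = fun _ => X₁ j := funext fun ω => by
      have : X 1 ω = X₁ := (H.path ω).init
      rw [this]
    rw [this]; exact AEBounded.const _
  · obtain ⟨n, rfl⟩ : ∃ n, t = n + 1 := ⟨t - 1, by omega⟩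
    have : (fun ω => X (n + 1) ω j) = fun ω => X₁ j -
        updateRate (g · ω) (X · ω) (n + 1) j • ∑ s ∈ Finset.Icc 1 n, g s ω j :=
      funext fun ω => (H.path ω).update n (by omega) j
    rw [this]
    refine (AEBounded.const _).sub (AEBounded.smul ⟨?_, 1, ?_⟩ (AEBounded.sum fun s hs =>
      H.aeBounded_feedback j (Finset.mem_Icc.1 hs).1))
    · exact (measurable_updateRate (fun _ h _ => H.measurable_feedback j h)
        (fun s h _ => measurable_profile_apply (H.measurable s h).1 j)).aestronglyMeasurable
    · refine Filter.Eventually.of_forall fun ω => ?_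
      beta_reduce
      rw [updateRate_eq, norm_inv, Real.norm_eq_abs, abs_of_pos (invRate_pos _ _ _ _)]
      exact inv_le_one_of_one_le₀ (one_le_invRate _ _ _ _)

theorem IsNoisyPlay.aeBounded_play (H : IsNoisyPlay μ ℓ L G σ q X₁ ξ X x g) (j : Fin N) {t : ℕ}
    (ht : 1 ≤ t) : AEBounded μ fun ω => x t ω j := by
  have : (fun ω => x t ω j) = fun ω => X t ω j -
      extrapolationRate q (g · ω) t j • g (t - 1) ω j := funext fun ω => (H.path ω).play t ht j
  rw [this]
  refine (H.aeBounded_iterate j ht).sub ((H.aeBounded_extrapolationRate j t).smul ?_)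
  rcases Nat.lt_or_ge t 2 with h2 | h2
  · obtain rfl : t = 1 := by omega
    have : (fun ω => g (1 - 1) ω j) = fun _ => 0 := funext fun ω => by
      have := (H.path ω).feedback_zero
      simp [this]
    rw [this]; exact AEBounded.const _
  · exact H.aeBounded_feedback j (by omega)

theorem IsNoisyPlay.measurable_grad (H : IsNoisyPlay μ ℓ L G σ q X₁ ξ X x g) (j : Fin N)
    {s t : ℕ} (hs : 1 ≤ s) (hst : s ≤ t) :
    Measurable[playHistory x t] fun ω => grad ℓ j (x s ω) :=
  (continuous_grad H.game j).measurable.comp (measurable_play x hs hst)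

/-- Thanks to the two-round delay, η_{s+1} involves only g_1, …, g_{s-1}, all readable from F_s. It
is thus an admissible weight against ξ_s. -/
theorem IsNoisyPlay.measurable_extrapolationRate_succ (H : IsNoisyPlay μ ℓ L G σ q X₁ ξ X x g)
    (j : Fin N) {s t : ℕ} (hst : s ≤ t) :
    Measurable[playHistory x t] fun ω => extrapolationRate q (g · ω) (s + 1) j :=
  measurable_extrapolationRate q fun r h1 h2 => (H.adapted j t).1 r h1 (by omega)

theorem IsNoisyPlay.aeBounded_sqrt_energy (H : IsNoisyPlay μ ℓ L G σ q X₁ ξ X x g) (j : Fin N)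
    (t : ℕ) : AEBounded μ fun ω => √(energy (g · ω) j t) := by
  refine ⟨(measurable_energy fun _ h _ => H.measurable_feedback j h).sqrt.aestronglyMeasurable,
    √(1 + ∑ s ∈ Finset.Icc 1 t, (G + σ) ^ 2), ?_⟩
  filter_upwards [H.norm_feedback_le] with ω hω
  rw [Real.norm_eq_abs, abs_of_nonneg (Real.sqrt_nonneg _)]
  refine Real.sqrt_le_sqrt (add_le_add le_rfl (Finset.sum_le_sum fun s hs => ?_))
  exact pow_le_pow_left₀ (norm_nonneg _) (hω s (Finset.mem_Icc.1 hs).1 j) 2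

theorem IsNoisyPlay.aeBounded_inv_sqrt_energy (H : IsNoisyPlay μ ℓ L G σ q X₁ ξ X x g) (j : Fin N)
    (t : ℕ) : AEBounded μ fun ω => (√(energy (g · ω) j t))⁻¹ := by
  refine ⟨(measurable_energy fun _ h _ =>
    H.measurable_feedback j h).sqrt.inv.aestronglyMeasurable, 1, ?_⟩
  refine Filter.Eventually.of_forall fun ω => ?_
  rw [norm_inv, Real.norm_eq_abs, abs_of_nonneg (Real.sqrt_nonneg _)]
  exact inv_le_one_of_one_le₀ (Real.one_le_sqrt.2 (one_le_energy _ _ _))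

theorem IsNoisyPlay.aeBounded_weightedGradSum (H : IsNoisyPlay μ ℓ L G σ q X₁ ξ X x g)
    (j : Fin N) (n : ℕ) :
    AEBounded μ fun ω => weightedGradSum ℓ q (x · ω) (g · ω) j n :=
  AEBounded.sum fun s hs => (H.aeBounded_extrapolationRate j (s + 1)).mul
    (H.aeBounded_grad j (Finset.mem_Icc.1 hs).1).norm_sq

theorem IsNoisyPlay.aeBounded_rpow_energy (H : IsNoisyPlay μ ℓ L G σ q X₁ ξ X x g) (hq : 0 < q)
    (j : Fin N) (t : ℕ) : AEBounded μ fun ω => energy (g · ω) j t ^ (1 / 2 + q) := by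
  refine ⟨((measurable_energy fun _ h _ =>
    H.measurable_feedback j h).pow_const _).aestronglyMeasurable,
    (1 + ∑ s ∈ Finset.Icc 1 t, (G + σ) ^ 2) ^ (1 / 2 + q), ?_⟩
  filter_upwards [H.norm_feedback_le] with ω hω
  have h0 := energy_pos (g · ω) j t
  rw [Real.norm_eq_abs, abs_of_nonneg (by positivity)]
  refine Real.rpow_le_rpow h0.le (add_le_add le_rfl (Finset.sum_le_sum fun s hs => ?_))
    (by linarith)
  exact pow_le_pow_left₀ (norm_nonneg _) (hω s (Finset.mem_Icc.1 hs).1 j) 2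

variable [IsProbabilityMeasure μ]

theorem IsNoisyPlay.integral_inner_noise (H : IsNoisyPlay μ ℓ L G σ q X₁ ξ X x g) (j : Fin N)
    {t : ℕ} (ht : 1 ≤ t) {f : Ω → EuclideanSpace ℝ (Fin (d j))}
    (hf : Measurable[playHistory x t] f) (hfb : AEBounded μ f) :
    ∫ ω, ⟪f ω, ξ t ω j⟫_ℝ ∂μ = 0 :=
  integral_inner_eq_zero_of_condExp (H.playHistory_le t) hf.stronglyMeasurable hfb
    (H.aeBounded_noise j ht) (H.noise.unbiased t ht j)

/-- Each summand pairs some ξ_t with a bounded F_t-measurable vector, hence integrates to zero. -/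
theorem IsNoisyPlay.noiseTerm_integral (H : IsNoisyPlay μ ℓ L G σ q X₁ ξ X x g) (j : Fin N)
    (n : ℕ) (p : EuclideanSpace ℝ (Fin (d j))) :
    AEBounded μ (fun ω => noiseTerm ℓ q (ξ · ω) (x · ω) (g · ω) j n p) ∧
      ∫ ω, noiseTerm ℓ q (ξ · ω) (x · ω) (g · ω) j n p ∂μ = 0 := by
  have b1 : ∀ t ∈ Finset.Icc 1 (n + 1), AEBounded μ fun ω => ⟪x t ω j, ξ t ω j⟫_ℝ := fun t ht =>
    (H.aeBounded_play j (Finset.mem_Icc.1 ht).1).inner (H.aeBounded_noise j (Finset.mem_Icc.1 ht).1)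
  have b2' : ∀ s ∈ Finset.Icc 1 n, AEBounded μ fun ω =>
      extrapolationRate q (g · ω) (s + 1) j • g s ω j := fun s hs =>
    (H.aeBounded_extrapolationRate j _).smul (H.aeBounded_feedback j (Finset.mem_Icc.1 hs).1)
  have b2 : ∀ s ∈ Finset.Icc 1 n, AEBounded μ fun ω =>
      ⟪extrapolationRate q (g · ω) (s + 1) j • g s ω j, ξ (s + 1) ω j⟫_ℝ := fun s hs =>
    (b2' s hs).inner (H.aeBounded_noise j (by omega))
  have b3' : ∀ s ∈ Finset.Icc 1 n, AEBounded μ fun ω =>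
      extrapolationRate q (g · ω) (s + 1) j • grad ℓ j (x s ω) := fun s hs =>
    (H.aeBounded_extrapolationRate j _).smul (H.aeBounded_grad j (Finset.mem_Icc.1 hs).1)
  have b3 : ∀ s ∈ Finset.Icc 1 n, AEBounded μ fun ω =>
      ⟪extrapolationRate q (g · ω) (s + 1) j • grad ℓ j (x s ω), ξ s ω j⟫_ℝ := fun s hs =>
    (b3' s hs).inner (H.aeBounded_noise j (Finset.mem_Icc.1 hs).1)
  have b4 : ∀ t ∈ Finset.Icc 1 (n + 1), AEBounded μ fun ω => ⟪p, ξ t ω j⟫_ℝ := fun t ht =>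
    (AEBounded.const p).inner (H.aeBounded_noise j (Finset.mem_Icc.1 ht).1)
  have i1 : ∀ t ∈ Finset.Icc 1 (n + 1), ∫ ω, ⟪x t ω j, ξ t ω j⟫_ℝ ∂μ = 0 := fun t ht =>
    have h := (Finset.mem_Icc.1 ht).1
    H.integral_inner_noise j h (measurable_profile_apply (measurable_play x h le_rfl) j)
      (H.aeBounded_play j h)
  have i2 : ∀ s ∈ Finset.Icc 1 n,
      ∫ ω, ⟪extrapolationRate q (g · ω) (s + 1) j • g s ω j, ξ (s + 1) ω j⟫_ℝ ∂μ = 0 := fun s hs =>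
    have h := (Finset.mem_Icc.1 hs).1
    H.integral_inner_noise j (by omega)
      ((H.measurable_extrapolationRate_succ j (by omega)).smul
        ((H.adapted j (s + 1)).1 s h (by omega))) (b2' s hs)
  have i3 : ∀ s ∈ Finset.Icc 1 n,
      ∫ ω, ⟪extrapolationRate q (g · ω) (s + 1) j • grad ℓ j (x s ω), ξ s ω j⟫_ℝ ∂μ = 0 :=
    fun s hs =>
    have h := (Finset.mem_Icc.1 hs).1
    H.integral_inner_noise j h ((H.measurable_extrapolationRate_succ j le_rfl).smul
      (H.measurable_grad j h le_rfl)) (b3' s hs)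
  have i4 : ∀ t ∈ Finset.Icc 1 (n + 1), ∫ ω, ⟪p, ξ t ω j⟫_ℝ ∂μ = 0 := fun t ht =>
    H.integral_inner_noise j (Finset.mem_Icc.1 ht).1 measurable_const (AEBounded.const p)
  have s1 := AEBounded.sum b1
  have s23 := AEBounded.sum fun s hs => (b2 s hs).add (b3 s hs)
  have s4 := AEBounded.sum b4
  simp only [noiseTerm, martingaleTerm, inner_sum]
  refine ⟨(s1.neg.sub s23).add s4, ?_⟩
  rw [integral_add (s1.neg.sub s23).integrable s4.integrable,
    integral_sub s1.neg.integrable s23.integrable, integral_neg,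
    integral_finsetSum _ fun t ht => (b1 t ht).integrable,
    integral_finsetSum _ fun s hs => ((b2 s hs).add (b3 s hs)).integrable,
    integral_finsetSum _ fun t ht => (b4 t ht).integrable,
    Finset.sum_eq_zero i1, Finset.sum_eq_zero i4, Finset.sum_eq_zero fun s hs => ?_]
  · simp
  · rw [integral_add (b2 s hs).integrable (b3 s hs).integrable, i2 s hs, i3 s hs, add_zero]

/-- Bias-variance decomposition of the feedback, with weights known before the noise. -/
theorem IsNoisyPlay.integral_mul_feedback_sq (H : IsNoisyPlay μ ℓ L G σ q X₁ ξ X x g) (j : Fin N)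
    {t : ℕ} (ht : 1 ≤ t) {w : Ω → ℝ} (hw : Measurable[playHistory x t] w) (hwb : AEBounded μ w) :
    ∫ ω, w ω * ‖g t ω j‖ ^ 2 ∂μ =
      ∫ ω, w ω * ‖grad ℓ j (x t ω)‖ ^ 2 ∂μ + ∫ ω, w ω * ‖ξ t ω j‖ ^ 2 ∂μ := by
  have hV := H.aeBounded_grad j ht
  have hξ := H.aeBounded_noise j ht
  have h0 := H.integral_inner_noise j ht (hw.smul (H.measurable_grad j ht le_rfl)) (hwb.smul hV)
  simp only [Pi.smul_apply'] at h0
  have e : (fun ω => w ω * ‖g t ω j‖ ^ 2) = fun ω => (w ω * ‖grad ℓ j (x t ω)‖ ^ 2 +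
      w ω * ‖ξ t ω j‖ ^ 2) + 2 * ⟪w ω • grad ℓ j (x t ω), ξ t ω j⟫_ℝ := by
    funext ω
    rw [(H.path ω).feedback t ht j, norm_add_sq_real, real_inner_smul_left]; ring
  rw [e, integral_add ((hwb.mul hV.norm_sq).add (hwb.mul hξ.norm_sq)).integrable
    (((hwb.smul hV).inner hξ).integrable.const_mul 2),
    integral_add (hwb.mul hV.norm_sq).integrable (hwb.mul hξ.norm_sq).integrable,
    integral_const_mul, h0, mul_zero, add_zero]

/-- The cumulated noise, normalized by the energy of the feedback. -/
theorem IsNoisyPlay.integral_normalized_noise_le (H : IsNoisyPlay μ ℓ L G σ q X₁ ξ X x g)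
    (j : Fin N) (T : ℕ) :
    ∫ ω, (√(energy (g · ω) j T))⁻¹ * ‖∑ t ∈ Finset.Icc 1 T, ξ t ω j‖ ^ 2 ∂μ ≤
      ∑ t ∈ Finset.Icc 1 T, ∫ ω, (√(energy (g · ω) j (t - 1)))⁻¹ * ‖g t ω j‖ ^ 2 ∂μ := by
  induction T with
  | zero => simp
  | succ n ih =>
    rw [Finset.sum_Icc_succ_top (by omega)]
    have hw := H.aeBounded_inv_sqrt_energy j n
    have hS : ∀ n, AEBounded μ fun ω => ∑ t ∈ Finset.Icc 1 n, ξ t ω j := fun n =>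
      AEBounded.sum fun t ht => H.aeBounded_noise j (Finset.mem_Icc.1 ht).1
    have hξ := H.aeBounded_noise j (t := n + 1) (by omega)
    have hwm : Measurable[playHistory x (n + 1)] fun ω => (√(energy (g · ω) j n))⁻¹ :=
      (measurable_energy fun s h1 h2 => (H.adapted j (n + 1)).1 s h1 (by omega)).sqrt.inv
    have hSm : Measurable[playHistory x (n + 1)] fun ω => ∑ t ∈ Finset.Icc 1 n, ξ t ω j := by
      refine Finset.measurable_fun_sum _ fun s hs => ?_
      have h := Finset.mem_Icc.1 hs
      have e : (fun ω => ξ s ω j) = fun ω => g s ω j - grad ℓ j (x s ω) := by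
        funext ω
        rw [(H.path ω).feedback s h.1 j]; abel
      rw [e]
      exact ((H.adapted j (n + 1)).1 s h.1 (by omega)).sub (H.measurable_grad j h.1 (by omega))
    have h0 := H.integral_inner_noise j (t := n + 1) (by omega) (hwm.smul hSm) (hw.smul (hS n))
    simp only [Pi.smul_apply'] at h0
    have h1 := H.integral_mul_feedback_sq j (t := n + 1) (by omega) hwm hw
    have h2 : 0 ≤ ∫ ω, (√(energy (g · ω) j n))⁻¹ * ‖grad ℓ j (x (n + 1) ω)‖ ^ 2 ∂μ :=
      integral_nonneg fun ω => by positivity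
    -- Since the energy is nondecreasing, the normalization may be moved back by one round, where it
    -- is known before ξ_{n+1}; the cross term then has mean zero.
    have h3 : ∫ ω, (√(energy (g · ω) j (n + 1)))⁻¹ *
        ‖∑ t ∈ Finset.Icc 1 (n + 1), ξ t ω j‖ ^ 2 ∂μ ≤
        ∫ ω, ((√(energy (g · ω) j n))⁻¹ * ‖∑ t ∈ Finset.Icc 1 n, ξ t ω j‖ ^ 2 +
          (√(energy (g · ω) j n))⁻¹ * ‖ξ (n + 1) ω j‖ ^ 2) + 2 *
          ⟪(√(energy (g · ω) j n))⁻¹ • ∑ t ∈ Finset.Icc 1 n, ξ t ω j, ξ (n + 1) ω j⟫_ℝ ∂μ := by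
      refine integral_mono ((H.aeBounded_inv_sqrt_energy j (n + 1)).mul
        (hS (n + 1)).norm_sq).integrable
        ((((hw.mul (hS n).norm_sq).add (hw.mul hξ.norm_sq)).integrable).add
          (((hw.smul (hS n)).inner hξ).integrable.const_mul 2)) fun ω => ?_
      have k1 : (√(energy (g · ω) j (n + 1)))⁻¹ ≤ (√(energy (g · ω) j n))⁻¹ :=
        inv_anti₀ (Real.sqrt_pos.2 (energy_pos _ _ _))
          (Real.sqrt_le_sqrt (energy_mono _ _ n.le_succ))
      refine (mul_le_mul_of_nonneg_right k1 (by positivity)).trans (le_of_eq ?_)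
      rw [Finset.sum_Icc_succ_top (by omega), norm_add_sq_real, real_inner_smul_left]; ring
    rw [integral_add ((hw.mul (hS n).norm_sq).add (hw.mul hξ.norm_sq)).integrable
      (((hw.smul (hS n)).inner hξ).integrable.const_mul 2),
      integral_add (hw.mul (hS n).norm_sq).integrable (hw.mul hξ.norm_sq).integrable,
      integral_const_mul, h0] at h3
    rw [Nat.add_sub_cancel]
    linarith

/-- The expected norm of the cumulated noise is controlled by the energy of the feedback. -/
theorem IsNoisyPlay.integral_norm_sum_noise_le (H : IsNoisyPlay μ ℓ L G σ q X₁ ξ X x g)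
    (j : Fin N) (T : ℕ) :
    ∫ ω, ‖∑ t ∈ Finset.Icc 1 T, ξ t ω j‖ ∂μ ≤
      (√(1 + 2 * (G + σ) ^ 2) + 1) * ∫ ω, √(energy (g · ω) j T) ∂μ := by
  have hS : AEBounded μ fun ω => ∑ t ∈ Finset.Icc 1 T, ξ t ω j :=
    AEBounded.sum fun t ht => H.aeBounded_noise j (Finset.mem_Icc.1 ht).1
  have hw := (H.aeBounded_inv_sqrt_energy j T).mul hS.norm_sq
  have hR := H.aeBounded_sqrt_energy j T
  have hR0 : 0 ≤ ∫ ω, √(energy (g · ω) j T) ∂μ := integral_nonneg fun ω => Real.sqrt_nonneg _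
  -- The inequality a ≤ (a²/r + r)/2 with r the root energy itself: the bound involves the energy
  -- rather than T, as part (b) requires.
  have h1 : ∫ ω, ‖∑ t ∈ Finset.Icc 1 T, ξ t ω j‖ ∂μ ≤
      ∫ ω, ((√(energy (g · ω) j T))⁻¹ * ‖∑ t ∈ Finset.Icc 1 T, ξ t ω j‖ ^ 2 +
        √(energy (g · ω) j T)) * (1 / 2) ∂μ := by
    refine integral_mono hS.norm.integrable ((hw.add hR).integrable.mul_const _) fun ω => ?_
    have hr : 0 < √(energy (g · ω) j T) := Real.sqrt_pos.2 (energy_pos _ _ _)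
    set r := √(energy (g · ω) j T)
    set a := ‖∑ t ∈ Finset.Icc 1 T, ξ t ω j‖
    have : (r⁻¹ * a ^ 2 + r) * (1 / 2) - a = (a - r) ^ 2 / r / 2 := by field_simp; ring
    have h2 : 0 ≤ (a - r) ^ 2 / r / 2 := by positivity
    linarith
  rw [integral_mul_const, integral_add hw.integrable hR.integrable] at h1
  have hb : ∀ t ∈ Finset.Icc 1 T, AEBounded μ fun ω =>
      (√(energy (g · ω) j (t - 1)))⁻¹ * ‖g t ω j‖ ^ 2 := fun t ht =>
    (H.aeBounded_inv_sqrt_energy j _).mul (H.aeBounded_feedback j (Finset.mem_Icc.1 ht).1).norm_sq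
  have h2 := H.integral_normalized_noise_le j T
  rw [← integral_finsetSum _ fun t ht => (hb t ht).integrable] at h2
  have h3 : ∫ ω, ∑ t ∈ Finset.Icc 1 T, (√(energy (g · ω) j (t - 1)))⁻¹ * ‖g t ω j‖ ^ 2 ∂μ ≤
      ∫ ω, 2 * √(1 + 2 * (G + σ) ^ 2) * √(energy (g · ω) j T) ∂μ := by
    refine integral_mono_ae (AEBounded.sum hb).integrable (hR.integrable.const_mul _) ?_
    filter_upwards [H.norm_feedback_le] with ω hω
    refine (Finset.sum_le_sum fun t _ => ?_).trans
      (sum_sq_div_sqrt_energy_le (g := (g · ω)) hω j T)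
    rw [div_eq_inv_mul]
    exact mul_le_mul_of_nonneg_right (inv_anti₀ (Real.sqrt_pos.2 (energy_pos _ _ _))
      (Real.sqrt_le_sqrt (energy_mono _ _ (by omega)))) (by positivity)
  rw [integral_const_mul] at h3
  linarith

/-- Under multiplicative noise the weighted gradients dominate a power of the energy that is
larger than its square root. -/
theorem IsNoisyPlay.integral_rpow_energy_le (H : IsNoisyPlay μ ℓ L G σ q X₁ ξ X x g) {σM : ℝ}
    (hq : 0 < q) (hσM : HasVarianceControl μ ℓ ξ x 0 σM) (j : Fin N) (n : ℕ) :
    ∫ ω, energy (g · ω) j (n + 1) ^ (1 / 2 + q) ∂μ ≤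
      (1 + σM ^ 2) * ∫ ω, weightedGradSum ℓ q (x · ω) (g · ω) j n ∂μ + (1 + (G + σ) ^ 2) := by
  have hb : ∀ s ∈ Finset.Icc 1 n, AEBounded μ fun ω =>
      extrapolationRate q (g · ω) (s + 1) j * ‖g s ω j‖ ^ 2 := fun s hs =>
    (H.aeBounded_extrapolationRate j _).mul (H.aeBounded_feedback j (Finset.mem_Icc.1 hs).1).norm_sq
  have hbV : ∀ s ∈ Finset.Icc 1 n, AEBounded μ fun ω =>
      extrapolationRate q (g · ω) (s + 1) j * ‖grad ℓ j (x s ω)‖ ^ 2 := fun s hs =>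
    (H.aeBounded_extrapolationRate j _).mul (H.aeBounded_grad j (Finset.mem_Icc.1 hs).1).norm_sq
  have h1 : ∫ ω, energy (g · ω) j (n + 1) ^ (1 / 2 + q) ∂μ ≤
      ∫ ω, ∑ s ∈ Finset.Icc 1 n, extrapolationRate q (g · ω) (s + 1) j * ‖g s ω j‖ ^ 2 +
        (1 + (G + σ) ^ 2) ∂μ := by
    refine integral_mono_ae (H.aeBounded_rpow_energy hq j _).integrable
      ((AEBounded.sum hb).add (AEBounded.const _)).integrable ?_
    filter_upwards [H.norm_feedback_le] with ω hω
    -- The rate η_{s+1} uses the energy at index s + 1 - 2, which is s - 1 by definition.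
    exact rpow_cumul_le_sum (a := fun s => ‖g s ω j‖ ^ 2) (fun _ => by positivity)
      (fun t ht => pow_le_pow_left₀ (norm_nonneg _) (hω t ht j) 2)
      (by linarith [H.le_quarter]) n
  rw [integral_add (AEBounded.sum hb).integrable (integrable_const _), integral_const,
    integral_finsetSum _ fun s hs => (hb s hs).integrable] at h1
  have h2 : ∫ ω, weightedGradSum ℓ q (x · ω) (g · ω) j n ∂μ = ∑ s ∈ Finset.Icc 1 n,
      ∫ ω, extrapolationRate q (g · ω) (s + 1) j * ‖grad ℓ j (x s ω)‖ ^ 2 ∂μ :=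
    integral_finsetSum _ fun s hs => (hbV s hs).integrable
  rw [h2, Finset.mul_sum]
  simp only [probReal_univ, one_smul] at h1
  refine h1.trans (add_le_add (Finset.sum_le_sum fun s hs => ?_) le_rfl)
  have hs1 := (Finset.mem_Icc.1 hs).1
  have hwm := H.measurable_extrapolationRate_succ j (s := s) le_rfl
  have hw := H.aeBounded_extrapolationRate j (s + 1)
  have h3 := H.integral_mul_feedback_sq j hs1 hwm hw
  have h4 := integral_mul_le_of_condExp_le (μ := μ) (H.playHistory_le s) hwm.stronglyMeasurable
    (fun ω => (extrapolationRate_pos _ _ _ _).le) hw (H.aeBounded_noise j hs1).norm_sq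
    ((AEBounded.const (0 ^ 2)).add
      ((AEBounded.const (σM ^ 2)).mul (H.aeBounded_grad j hs1).norm_sq)) (hσM s hs1 j)
  have h5 : (fun ω => extrapolationRate q (g · ω) (s + 1) j *
      (0 ^ 2 + σM ^ 2 * ‖grad ℓ j (x s ω)‖ ^ 2)) =
      fun ω => σM ^ 2 * (extrapolationRate q (g · ω) (s + 1) j * ‖grad ℓ j (x s ω)‖ ^ 2) := by
    funext ω; ring
  rw [h5, integral_const_mul] at h4
  linarith

end Expectation

/-! ### From root energies to regret bounds in expectation. -/

section Regret

variable {N : ℕ} {d : Fin N → ℕ} {ℓ : Fin N → Profile d → ℝ} {L : ℝ≥0} {G σ q : ℝ}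
  {X₁ : Profile d}

/-- A random variable that dominates the linearized regret with respect to all comparators in a
ball, with expectation controlled by the expected root energies. -/
theorem exists_dominating (hℓ : IsSmoothConvexGame ℓ L) (hG : ∀ i x, ‖grad ℓ i x‖ ≤ G) (σ : ℝ)
    (X₁ z : Profile d) (hz : ∀ x, 0 ≤ ∑ i, ⟪grad ℓ i x, x i - z i⟫_ℝ) {ρ : ℝ} (hρ : 0 ≤ ρ)
    (i : Fin N) :
    ∃ K : ℝ, 1 ≤ K ∧ ∀ (q : ℝ) (Ω : Type*) [MeasurableSpace Ω] (μ : Measure Ω)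
      [IsProbabilityMeasure μ] (ξ X x g : ℕ → Ω → Profile d),
      IsNoisyPlay μ ℓ L G σ q X₁ ξ X x g → ∀ n : ℕ,
      (∑ j, ∫ ω, weightedGradSum ℓ q (x · ω) (g · ω) j n ∂μ ≤
        K * (1 + ∑ j, ∫ ω, √(energy (g · ω) j (n + 1)) ∂μ)) ∧
      ∃ Z : Ω → ℝ, Integrable Z μ ∧
        (∀ᵐ ω ∂μ, ∀ p, ‖p‖ ≤ ρ → linRegret ℓ i (x · ω) (n + 1) p ≤ Z ω) ∧
        ∫ ω, Z ω ∂μ ≤ K * (1 + ∑ j, ∫ ω, √(energy (g · ω) j (n + 1)) ∂μ) := by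
  obtain ⟨K, c, hK, hpath⟩ := exists_pathwise_bound (G + σ) ρ X₁ z hℓ.lipschitz hG hz
  set κ := √(1 + 2 * (G + σ) ^ 2) + 1
  have hκ : 0 ≤ κ := by positivity
  refine ⟨K + ρ * κ, by nlinarith, fun q Ω _ μ _ ξ X x g H n => ?_⟩
  have hR0 : ∀ j : Fin N, 0 ≤ ∫ ω, √(energy (g · ω) j (n + 1)) ∂μ :=
    fun j => integral_nonneg fun ω => Real.sqrt_nonneg _
  have hR0' : 0 ≤ ∑ j, ∫ ω, √(energy (g · ω) j (n + 1)) ∂μ := Finset.sum_nonneg fun j _ => hR0 j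
  have hR : AEBounded μ fun ω => ∑ j, √(energy (g · ω) j (n + 1)) :=
    AEBounded.sum fun j _ => H.aeBounded_sqrt_energy j (n + 1)
  have hKR : AEBounded μ fun ω => K * (1 + ∑ j, √(energy (g · ω) j (n + 1))) :=
    (AEBounded.const K).mul ((AEBounded.const 1).add hR)
  have hν : AEBounded μ fun ω => ∑ j, noiseTerm ℓ q (ξ · ω) (x · ω) (g · ω) j n (z j) :=
    AEBounded.sum fun j _ => (H.noiseTerm_integral j n (z j)).1
  have iR : ∫ ω, K * (1 + ∑ j, √(energy (g · ω) j (n + 1))) ∂μ =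
      K * (1 + ∑ j, ∫ ω, √(energy (g · ω) j (n + 1)) ∂μ) := by
    rw [integral_const_mul, integral_add (integrable_const _) hR.integrable,
      integral_finsetSum _ fun j _ => (H.aeBounded_sqrt_energy j (n + 1)).integrable]
    simp
  have iν : ∫ ω, ∑ j, noiseTerm ℓ q (ξ · ω) (x · ω) (g · ω) j n (z j) ∂μ = 0 := by
    rw [integral_finsetSum _ fun j _ => (H.noiseTerm_integral j n (z j)).1.integrable]
    exact Finset.sum_eq_zero fun j _ => (H.noiseTerm_integral j n (z j)).2
  have hext : 0 ≤ ρ * κ * (1 + ∑ j, ∫ ω, √(energy (g · ω) j (n + 1)) ∂μ) := by positivity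
  constructor
  · rw [← integral_finsetSum _ fun j _ => (H.aeBounded_weightedGradSum j n).integrable]
    have h1 : ∫ ω, ∑ j, weightedGradSum ℓ q (x · ω) (g · ω) j n ∂μ ≤
        ∫ ω, ∑ j, noiseTerm ℓ q (ξ · ω) (x · ω) (g · ω) j n (z j) +
          K * (1 + ∑ j, √(energy (g · ω) j (n + 1))) ∂μ := by
      refine integral_mono_ae (AEBounded.sum fun j _ => H.aeBounded_weightedGradSum j n).integrable
        (hν.add hKR).integrable ?_
      filter_upwards [H.norm_feedback_le] with ω hω
      exact (hpath q H.le_quarter _ _ _ _ (H.path ω) hω n).1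
    rw [integral_add hν.integrable hKR.integrable, iR, iν] at h1
    linarith
  · have hS : AEBounded μ fun ω => ∑ t ∈ Finset.Icc 1 (n + 1), ξ t ω i :=
      AEBounded.sum fun t ht => H.aeBounded_noise i (Finset.mem_Icc.1 ht).1
    have h0 := H.noiseTerm_integral i n 0
    have hρS : AEBounded μ fun ω => ρ * ‖∑ t ∈ Finset.Icc 1 (n + 1), ξ t ω i‖ :=
      (AEBounded.const ρ).mul hS.norm
    have hcν := (AEBounded.const (μ := μ) c).mul hν
    -- The comparator enters the noise only through ⟨p, ∑ξ_t⟩, so Cauchy–Schwarz on the ball of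
    -- radius ρ makes the bound uniform in p.
    refine ⟨fun ω => noiseTerm ℓ q (ξ · ω) (x · ω) (g · ω) i n 0 +
      ρ * ‖∑ t ∈ Finset.Icc 1 (n + 1), ξ t ω i‖ +
      c * ∑ j, noiseTerm ℓ q (ξ · ω) (x · ω) (g · ω) j n (z j) +
      K * (1 + ∑ j, √(energy (g · ω) j (n + 1))), (((h0.1.add hρS).add hcν).add hKR).integrable,
      ?_, ?_⟩
    · filter_upwards [H.norm_feedback_le] with ω hω p hp
      have h1 := (hpath q H.le_quarter _ _ _ _ (H.path ω) hω n).2 i p hp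
      have h2 : noiseTerm ℓ q (ξ · ω) (x · ω) (g · ω) i n p ≤
          noiseTerm ℓ q (ξ · ω) (x · ω) (g · ω) i n 0 +
            ρ * ‖∑ t ∈ Finset.Icc 1 (n + 1), ξ t ω i‖ := by
        rw [noiseTerm, noiseTerm, inner_zero_left, add_zero]
        exact add_le_add le_rfl ((real_inner_le_norm _ _).trans
          (mul_le_mul_of_nonneg_right hp (norm_nonneg _)))
      linarith
    · rw [integral_add ((h0.1.add hρS).add hcν).integrable hKR.integrable,
        integral_add (h0.1.add hρS).integrable hcν.integrable,
        integral_add h0.1.integrable hρS.integrable, h0.2, iR, integral_const_mul,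
        integral_const_mul, iν]
      have h1 := mul_le_mul_of_nonneg_left (H.integral_norm_sum_noise_le i (n + 1)) hρ
      have h2 := Finset.single_le_sum (f := fun j => ∫ ω, √(energy (g · ω) j (n + 1)) ∂μ)
        (fun j _ => hR0 j) (Finset.mem_univ i)
      have h3 := mul_le_mul_of_nonneg_left h2 (mul_nonneg hρ hκ)
      have h4 : 0 ≤ ρ * κ := mul_nonneg hρ hκ
      linarith

section Play

variable {Ω : Type*} [MeasurableSpace Ω] {μ : Measure Ω} {ξ X x g : ℕ → Ω → Profile d}

theorem IsNoisyPlay.measurable_linRegret (H : IsNoisyPlay μ ℓ L G σ q X₁ ξ X x g) (i : Fin N)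
    (T : ℕ) (p : EuclideanSpace ℝ (Fin (d i))) :
    Measurable fun ω => linRegret ℓ i (x · ω) T p :=
  Finset.measurable_fun_sum _ fun t ht => by
    have hx := (H.measurable t (Finset.mem_Icc.1 ht).1).2.1
    exact ((continuous_grad H.game i).measurable.comp hx).inner
      ((measurable_profile_apply hx i).sub measurable_const)

theorem IsNoisyPlay.measurable_regret (H : IsNoisyPlay μ ℓ L G σ q X₁ ξ X x g) (i : Fin N)
    (T : ℕ) (p : EuclideanSpace ℝ (Fin (d i))) :
    Measurable fun ω => regret ℓ i (x · ω) T p :=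
  Finset.measurable_fun_sum _ fun t ht =>
    (H.game.continuous_sub_deviate i p).measurable.comp
      (H.measurable t (Finset.mem_Icc.1 ht).1).2.1

theorem IsNoisyPlay.sum_dist_le (H : IsNoisyPlay μ ℓ L G σ q X₁ ξ X x g) {ρ : ℝ} (i : Fin N)
    (T : ℕ) (ω : Ω) {p : EuclideanSpace ℝ (Fin (d i))} (hp : ‖p‖ ≤ ρ) :
    ∑ t ∈ Finset.Icc 1 T, G * ‖x t ω i - p‖ ≤ ∑ t ∈ Finset.Icc 1 T, G * (‖x t ω i‖ + ρ) :=
  Finset.sum_le_sum fun t _ => mul_le_mul_of_nonneg_left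
    ((norm_sub_le _ _).trans (add_le_add le_rfl hp))
    ((norm_nonneg _).trans (H.grad_le i (x t ω)))

theorem IsNoisyPlay.exists_sum_le (H : IsNoisyPlay μ ℓ L G σ q X₁ ξ X x g) (ρ : ℝ) (i : Fin N)
    (T : ℕ) : ∃ C : ℝ, ∀ᵐ ω ∂μ, ∑ t ∈ Finset.Icc 1 T, G * (‖x t ω i‖ + ρ) ≤ C := by
  obtain ⟨C, hC⟩ := (AEBounded.sum fun t (ht : t ∈ Finset.Icc 1 T) =>
    (AEBounded.const (μ := μ) G).mul
      ((H.aeBounded_play i (Finset.mem_Icc.1 ht).1).norm.add (AEBounded.const ρ))).2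
  exact ⟨C, by filter_upwards [hC] with ω hω using (le_abs_self _).trans hω⟩

variable [IsProbabilityMeasure μ]

theorem IsNoisyPlay.supExpectationLE (H : IsNoisyPlay μ ℓ L G σ q X₁ ξ X x g) {ρ : ℝ} {i : Fin N}
    {P : Set (EuclideanSpace ℝ (Fin (d i)))} (hP : ∀ p ∈ P, ‖p‖ ≤ ρ) {T : ℕ} {Z : Ω → ℝ} {c : ℝ}
    (hZ : Integrable Z μ) (hZc : ∫ ω, Z ω ∂μ ≤ c)
    (hRZ : ∀ᵐ ω ∂μ, ∀ p, ‖p‖ ≤ ρ → linRegret ℓ i (x · ω) T p ≤ Z ω) :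
    SupExpectationLE μ P (fun p ω => linRegret ℓ i (x · ω) T p) c ∧
      SupExpectationLE μ P (fun p ω => regret ℓ i (x · ω) T p) c := by
  obtain ⟨C, hC⟩ := H.exists_sum_le ρ i T
  constructor
  · refine supExpectationLE_of_le (H.measurable_linRegret i T) (fun ω p hp =>
      (abs_linRegret_le H.grad_le i _ T p).trans (H.sum_dist_le i T ω (hP p hp))) hC hZ ?_ hZc
    filter_upwards [hRZ] with ω hω p hp using hω p (hP p hp)
  · refine supExpectationLE_of_le (H.measurable_regret i T) (fun ω p hp =>
      (abs_regret_le H.game H.grad_le i _ T p).trans (H.sum_dist_le i T ω (hP p hp))) hC hZ ?_ hZc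
    filter_upwards [hRZ] with ω hω p hp using
      (H.game.regret_le_linRegret i _ T p).trans (hω p (hP p hp))

theorem IsNoisyPlay.expectationSupLE (H : IsNoisyPlay μ ℓ L G σ q X₁ ξ X x g) {ρ : ℝ} {i : Fin N}
    {P : Set (EuclideanSpace ℝ (Fin (d i)))} (hP : ∀ p ∈ P, ‖p‖ ≤ ρ) {T : ℕ} {Z : Ω → ℝ} {c : ℝ}
    (hc : 0 ≤ c) (hZ : Integrable Z μ) (hZc : ∫ ω, Z ω ∂μ ≤ c)
    (hRZ : ∀ᵐ ω ∂μ, ∀ p, ‖p‖ ≤ ρ → linRegret ℓ i (x · ω) T p ≤ Z ω) :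
    ExpectationSupLE μ P (fun p ω => linRegret ℓ i (x · ω) T p) c ∧
      ExpectationSupLE μ P (fun p ω => regret ℓ i (x · ω) T p) c := by
  obtain ⟨C, hC⟩ := H.exists_sum_le ρ i T
  constructor
  · refine expectationSupLE_of_le (fun ω => continuous_linRegret i _ T)
      (H.measurable_linRegret i T) (fun ω p hp => (abs_linRegret_le H.grad_le i _ T p).trans
        (H.sum_dist_le i T ω (hP p hp))) hC hc hZ ?_ hZc
    filter_upwards [hRZ] with ω hω p hp using hω p (hP p hp)
  · refine expectationSupLE_of_le (fun ω => continuous_regret H.game i _ T)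
      (H.measurable_regret i T) (fun ω p hp => (abs_regret_le H.game H.grad_le i _ T p).trans
        (H.sum_dist_le i T ω (hP p hp))) hC hc hZ ?_ hZc
    filter_upwards [hRZ] with ω hω p hp using
      (H.game.regret_le_linRegret i _ T p).trans (hω p (hP p hp))

/-- The energies grow at most linearly. -/
theorem IsNoisyPlay.integral_sqrt_energy_le (H : IsNoisyPlay μ ℓ L G σ q X₁ ξ X x g) (j : Fin N)
    (n : ℕ) :
    ∫ ω, √(energy (g · ω) j (n + 1)) ∂μ ≤ √(1 + (G + σ) ^ 2) * √((n + 1 : ℕ) : ℝ) := by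
  have h1 : ∫ ω, √(energy (g · ω) j (n + 1)) ∂μ ≤
      ∫ _, √(1 + (G + σ) ^ 2) * √((n + 1 : ℕ) : ℝ) ∂μ := by
    refine integral_mono_ae (H.aeBounded_sqrt_energy j _).integrable (integrable_const _) ?_
    filter_upwards [H.norm_feedback_le] with ω hω
    rw [← Real.sqrt_mul (by positivity)]
    refine Real.sqrt_le_sqrt ?_
    have h2 : ∑ s ∈ Finset.Icc 1 (n + 1), ‖g s ω j‖ ^ 2 ≤
        ∑ s ∈ Finset.Icc 1 (n + 1), (G + σ) ^ 2 := Finset.sum_le_sum fun s hs =>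
      pow_le_pow_left₀ (norm_nonneg _) (hω s (Finset.mem_Icc.1 hs).1 j) 2
    rw [Finset.sum_const, Nat.card_Icc, nsmul_eq_mul, Nat.add_sub_cancel] at h2
    rw [energy, cumul]
    push_cast at h2 ⊢
    have h3 : (0 : ℝ) ≤ n := Nat.cast_nonneg n
    linarith
  simpa using h1

/-- Under multiplicative noise the expected root energies are bounded. -/
theorem IsNoisyPlay.sum_integral_sqrt_energy_le (H : IsNoisyPlay μ ℓ L G σ q X₁ ξ X x g)
    {σM K : ℝ} (hq : 0 < q) (hσM : HasVarianceControl μ ℓ ξ x 0 σM) (hK : 1 ≤ K) {n : ℕ}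
    (hH : (1 + σM ^ 2) * ∑ j, ∫ ω, weightedGradSum ℓ q (x · ω) (g · ω) j n ∂μ +
      N * (1 + (G + σ) ^ 2) ≤ K * (1 + ∑ j, ∫ ω, √(energy (g · ω) j (n + 1)) ∂μ)) :
    ∑ j, ∫ ω, √(energy (g · ω) j (n + 1)) ∂μ ≤
      1 + 2 * N * Real.exp (Real.log (2 * K) * (1 / (2 * q))) := by
  set e := Real.exp (Real.log (2 * K) * (1 / (2 * q)))
  have h1 : ∀ j ∈ Finset.univ, K * ∫ ω, √(energy (g · ω) j (n + 1)) ∂μ ≤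
      (∫ ω, energy (g · ω) j (n + 1) ^ (1 / 2 + q) ∂μ) / 2 + K * e := by
    intro j _
    have hU := H.aeBounded_rpow_energy hq j (n + 1)
    have h2 : ∫ ω, K * √(energy (g · ω) j (n + 1)) ∂μ ≤
        ∫ ω, energy (g · ω) j (n + 1) ^ (1 / 2 + q) / 2 + K * e ∂μ :=
      integral_mono ((H.aeBounded_sqrt_energy j _).integrable.const_mul K)
        ((hU.integrable.div_const 2).add (integrable_const _))
        fun ω => mul_sqrt_le_rpow_add hK (one_le_energy _ _ _) hq
    rw [integral_const_mul, integral_add (hU.integrable.div_const 2) (integrable_const _),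
      integral_div] at h2
    simpa using h2
  have h2 := Finset.sum_le_sum h1
  have h3 := Finset.sum_le_sum fun j (_ : j ∈ Finset.univ) => H.integral_rpow_energy_le hq hσM j n
  simp only [Finset.sum_add_distrib, ← Finset.mul_sum, ← Finset.sum_div, Finset.sum_const,
    Finset.card_univ, Fintype.card_fin, nsmul_eq_mul] at h2 h3
  set R := ∑ j, ∫ ω, √(energy (g · ω) j (n + 1)) ∂μ
  -- Together the estimates give K R ≤ K (1 + R) / 2 + N K e, and the R on the right is absorbed.
  have h4 : K * R ≤ K * (1 + 2 * N * e) := by linarith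
  exact le_of_mul_le_mul_left h4 (by linarith)

end Play

end Regret

end NoisyGame

/-! ### The two regret bounds. -/

open NoisyGame in
theorem mainTheorem3 {N : ℕ} {d : Fin N → ℕ} (ℓ : Fin N → Profile d → ℝ) (L : ℝ≥0) (G σ σM : ℝ)
    (hℓ : IsSmoothConvexGame ℓ L) (hVS : IsVariationallyStable ℓ)
    (hG : ∀ i x, ‖grad ℓ i x‖ ≤ G) (X₁ : Profile d)
    (i : Fin N) (P : Set (EuclideanSpace ℝ (Fin (d i)))) (hP : Bornology.IsBounded P) :
    (∃ C : ℝ, ∀ q : ℝ, 0 < q → q ≤ 1 / 4 →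
      ∀ (Ω : Type*) [MeasurableSpace Ω] (μ : Measure Ω) [IsProbabilityMeasure μ]
        (ξ X x g : ℕ → Ω → Profile d),
      (∀ ω, IsAdaptiveOptDAPlus ℓ q X₁ (ξ · ω) (X · ω) (x · ω) (g · ω)) →
      IsUnbiasedBoundedNoise μ ξ x σ →
      ∀ T : ℕ,
        SupExpectationLE μ P (fun p ω => linRegret ℓ i (x · ω) T p) (C * √T) ∧
        SupExpectationLE μ P (fun p ω => regret ℓ i (x · ω) T p) (C * √T)) ∧
    (∃ A B : ℝ, ∀ q : ℝ, 0 < q → q ≤ 1 / 4 →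
      ∀ (Ω : Type*) [MeasurableSpace Ω] (μ : Measure Ω) [IsProbabilityMeasure μ]
        (ξ X x g : ℕ → Ω → Profile d),
      (∀ ω, IsAdaptiveOptDAPlus ℓ q X₁ (ξ · ω) (X · ω) (x · ω) (g · ω)) →
      IsUnbiasedBoundedNoise μ ξ x σ →
      HasVarianceControl μ ℓ ξ x 0 σM →
      ∀ T : ℕ,
        ExpectationSupLE μ P (fun p ω => linRegret ℓ i (x · ω) T p)
          (A * Real.exp (B * (1 / (2 * q)))) ∧
        ExpectationSupLE μ P (fun p ω => regret ℓ i (x · ω) T p)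
          (A * Real.exp (B * (1 / (2 * q))))) := by
  obtain ⟨z, hz⟩ := hVS.exists_nash
  obtain ⟨ρ, hρ, hPρ⟩ := hP.exists_pos_norm_le
  constructor
  · obtain ⟨K, hK, hdom⟩ :=
      exists_dominating hℓ hG σ X₁ z (fun x => hVS.stable x z hz) hρ.le i
    refine ⟨K * (1 + N * √(1 + (G + σ) ^ 2)), fun q hq hq4 Ω _ μ _ ξ X x g hpath hnoise T => ?_⟩
    have H : IsNoisyPlay μ ℓ L G σ q X₁ ξ X x g := ⟨hℓ, hG, hq4, hpath, hnoise⟩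
    rcases T with _ | n
    · exact H.supExpectationLE hPρ (integrable_zero Ω ℝ μ) (by simp)
        (Filter.Eventually.of_forall fun ω p _ => by simp [linRegret])
    · obtain ⟨-, Z, hZ, hRZ, hZK⟩ := hdom q Ω μ ξ X x g H n
      refine H.supExpectationLE hPρ hZ (hZK.trans ?_) hRZ
      have h1 := Finset.sum_le_sum fun j (_ : j ∈ Finset.univ) => H.integral_sqrt_energy_le j n
      rw [Finset.sum_const, Finset.card_univ, Fintype.card_fin, nsmul_eq_mul] at h1
      have h2 : 1 ≤ √((n + 1 : ℕ) : ℝ) := Real.one_le_sqrt.2 (by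
        push_cast; linarith [n.cast_nonneg (α := ℝ)])
      rw [mul_assoc]
      exact mul_le_mul_of_nonneg_left (by linarith) (by linarith)
  · obtain ⟨K, hK, hdom⟩ :=
      exists_dominating hℓ hG σ X₁ z (fun x => hVS.stable x z hz) hρ.le i
    -- Chosen so that the variance factor and the additive constants of
    -- `IsNoisyPlay.integral_rpow_energy_le` all fit under K' (1 + R), R being the sum of the
    -- expected root energies. It does not depend on q.
    set K' := (1 + σM ^ 2) * K + N * (1 + (G + σ) ^ 2) with hK'
    have hK'1 : 1 ≤ K' := by
      have : 0 ≤ σM ^ 2 * K := by positivity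
      have : 0 ≤ N * (1 + (G + σ) ^ 2) := by positivity
      linarith
    refine ⟨K * (2 + 2 * N), Real.log (2 * K'),
      fun q hq hq4 Ω _ μ _ ξ X x g hpath hnoise hσM T => ?_⟩
    have H : IsNoisyPlay μ ℓ L G σ q X₁ ξ X x g := ⟨hℓ, hG, hq4, hpath, hnoise⟩
    have he : 1 ≤ Real.exp (Real.log (2 * K') * (1 / (2 * q))) := Real.one_le_exp
      (mul_nonneg (Real.log_nonneg (by linarith)) (by positivity))
    have hc : 0 ≤ K * (2 + 2 * N) * Real.exp (Real.log (2 * K') * (1 / (2 * q))) := by positivity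
    rcases T with _ | n
    · exact H.expectationSupLE hPρ hc (integrable_zero Ω ℝ μ) (by simpa using hc)
        (Filter.Eventually.of_forall fun ω p _ => by simp [linRegret])
    · obtain ⟨hH, Z, hZ, hRZ, hZK⟩ := hdom q Ω μ ξ X x g H n
      refine H.expectationSupLE hPρ hc hZ (hZK.trans ?_) hRZ
      have hR0 : 0 ≤ ∑ j, ∫ ω, √(energy (g · ω) j (n + 1)) ∂μ :=
        Finset.sum_nonneg fun j _ => integral_nonneg fun ω => Real.sqrt_nonneg _
      have h1 := H.sum_integral_sqrt_energy_le hq hσM hK'1 (n := n) (by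
        have k1 := mul_le_mul_of_nonneg_left hH (show 0 ≤ 1 + σM ^ 2 by positivity)
        have k2 : 0 ≤ N * (1 + (G + σ) ^ 2) *
          ∑ j, ∫ ω, √(energy (g · ω) j (n + 1)) ∂μ := by positivity
        rw [hK']
        linarith)
      rw [mul_assoc]
      refine mul_le_mul_of_nonneg_left ?_ (by linarith)
      linarith
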